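/- A linear relation in $\mathbb C^m$ ($m\ge 0$) is a linear subspace $S\subseteq\mathbb C^m\times\mathbb C^m$. Put $\operatorname{dom}S=\{x:(x,y)\in S\text{ for some }y\}$, $R(S)=\{y:(x,y)\in S\text{ for some }x\}$, $N(S)=\{x:(x,0)\in S\}$, $\operatorname{mul}S=\{y:(0,y)\in S\}$, $S-\lambda=\{(x,y-\lambda x):(x,y)\in S\}$; let $S^0$ be the identity relation and $S^{k+1}=S\,S^k=\{(x,z):(x,y)\in S^k,\ (y,z)\in S\text{ for some }y\}$. Let $\mathcal R_\lambda(S)=\bigcup_k N((S-\lambda)^k)$, $\mathcal R_\infty(S)=\bigcup_k\operatorname{mul}S^k$ and $\mathcal R_c(S)=\mathcal R_0(S)\cap\mathcal R_\infty(S)$. A number $\lambda\in\mathbb C$ is a proper eigenvalue of $S$ if $N(S-\lambda)\ne\{0\}$ and $\mathcal R_\lambda(S)\not\subseteq\mathcal R_c(S)$. The Weyr characteristic $(W,A,B,C)$ of $S$ consists of the finite sequences (zero entries being omitted) given for $k\ge1$ by $$W_k(\lambda)=\dim\frac{N((S-\lambda)^k)+\mathcal R_c(S)}{N((S-\lambda)^{k-1})+\mathcal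 R_c(S)},\quad A_k=\dim\frac{\operatorname{mul}(S^k)+\mathcal R_c(S)}{\operatorname{mul}(S^{k-1})+\mathcal R_c(S)},\quad B_k=\dim\frac{N(S^k)\cap\mathcal R_c(S)}{N(S^{k-1})\cap\mathcal R_c(S)},$$ $$C_1=\dim\frac{R(S)+\operatorname{dom}S}{R(S)+\mathcal R_0(S)},\qquad C_k=\dim\frac{R(S^k)+\mathcal R_0(S)}{R(S^{k+1})+\mathcal R_0(S)}\quad(k\ge2),$$ where $W$ is the collection of the sequences $W(\lambda)$ over the proper eigenvalues $\lambda\in\mathbb C$ of $S$. Write $|\cdot|$ for the sum of all entries, and $B_1=0$ if $B$ is empty. For $E,F\in\mathbb C^{n\times m}$ the kernel representation of the pencil $P(s)=sE-F$ is $E^{-1}F=\{(x,y)\in\mathbb C^m\times\mathbb C^m: Fx=Ey\}$. The Kronecker canonical form of $P$ is the block diagonal pencil strictly equivalent to $P$ with blocks $sI-J_0$ ($J_0$ in Jordan normal form), $sN_{\alpha_i}-I$ ($N_k$ the nilpotent $k\times k$ Jordan block with ones below the diagonal), $sK_{\beta_i}-L_{\beta_i}$ and $sK_{\gamma_i}^\top-L_{\gamma_i}^\top$,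 where $K_k=[I_{k-1}\ 0]$, $L_k=[0\ I_{k-1}]\in\mathbb C^{(k-1)\times k}$ and $\alpha_i,\beta_i,\gamma_i\geq 1$. The Weyr characteristic $(w,a,b,c)$ of $P$ consists of the conjugate partitions of the Jordan block sizes of $J_0$ (for each eigenvalue separately) and of the multi-indices $\alpha,\beta,\gamma$, respectively. **Statement.** Let $S$ be a linear relation in $\mathbb C^m$ with Weyr characteristic $(W,A,B,C)$. Then $$n=2m-|W|-|A|-|B|-B_1-|C|$$ is the smallest number of rows for which there are matrices $E,F\in\mathbb C^{n\times m}$ with $E^{-1}F=S$ (matrices with $n=0$ rows are admitted; $n=0$ holds exactly if $S=\mathbb C^m\times\mathbb C^m$). Moreover, whenever $E,F\in\mathbb C^{n\times m}$ with this minimal $n$ satisfy $E^{-1}F=S$, the Weyr characteristic $(w,a,b,c)$ of the pencil $sE-F$ is given by $w=W$, $a=A$, $b=B$ and $$c=(d,\ d,\ C_1,\ C_2,\ C_3,\dots),\qquad d=m-|W|-|A|-|B|-|C|\ge0$$ (zero entries again being omitted). -/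

import Mathlib

noncomputable section

/-! ### Linear relations and their Weyr characteristic -/

/-- A linear relation in `V` is a linear subspace of `V × V`. -/
abbrev LinRel (V : Type*) [AddCommGroup V] [Module ℂ V] := Submodule ℂ (V × V)

namespace LinRel

variable {V : Type*} [AddCommGroup V] [Module ℂ V]

/-- The domain `{x | (x, y) ∈ S for some y}`. -/
def dom (S : LinRel V) : Submodule ℂ V := Submodule.map (LinearMap.fst ℂ V V) S

/-- The range `{y | (x, y) ∈ S for some x}`. -/
def ran (S : LinRel V) : Submodule ℂ V := Submodule.map (LinearMap.snd ℂ V V) S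

/-- The kernel `{x | (x, 0) ∈ S}`. -/
def ker (S : LinRel V) : Submodule ℂ V := Submodule.comap (LinearMap.inl ℂ V V) S

/-- The multivalued part `{y | (0, y) ∈ S}`. -/
def mul (S : LinRel V) : Submodule ℂ V := Submodule.comap (LinearMap.inr ℂ V V) S

/-- The product `S T = {(x, z) | (x, y) ∈ T and (y, z) ∈ S for some y}`. -/
def comp (S T : LinRel V) : LinRel V where
  carrier := {p | ∃ y, (p.1, y) ∈ T ∧ (y, p.2) ∈ S}
  zero_mem' := ⟨0, T.zero_mem, S.zero_mem⟩
  add_mem' := by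
    rintro a b ⟨y, h1, h2⟩ ⟨z, h3, h4⟩
    exact ⟨y + z, T.add_mem h1 h3, S.add_mem h2 h4⟩
  smul_mem' := by
    rintro c a ⟨y, h1, h2⟩
    exact ⟨c • y, T.smul_mem c h1, S.smul_mem c h2⟩

/-- The powers of a linear relation: `S ^ 0` is the identity relation (the graph of the identity
map) and `S ^ (k + 1) = S (S ^ k)`. -/
def iter (S : LinRel V) : ℕ → LinRel V
  | 0 => LinearMap.graph (LinearMap.id : V →ₗ[ℂ] V)
  | k + 1 => comp S (iter S k)

/-- The relation `S - μ = {(x, y - μ x) | (x, y) ∈ S}`. -/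
def shift (S : LinRel V) (μ : ℂ) : LinRel V :=
  Submodule.map
    (LinearMap.prod (LinearMap.fst ℂ V V) (LinearMap.snd ℂ V V - μ • LinearMap.fst ℂ V V)) S

/-- The root manifold at `μ ∈ ℂ`: the union of the increasing sequence of subspaces
`N((S - μ) ^ k)`. -/
def rootMfd (S : LinRel V) (μ : ℂ) : Submodule ℂ V := ⨆ k : ℕ, ker (iter (shift S μ) k)

/-- The root manifold at `∞`: the union of the increasing sequence of subspaces `mul (S ^ k)`. -/
def rootMfdInfty (S : LinRel V) : Submodule ℂ V := ⨆ k : ℕ, mul (iter S k)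

/-- The singular chains subspace `R_c(S) = R_0(S) ∩ R_∞(S)`. -/
def singChains (S : LinRel V) : Submodule ℂ V := rootMfd S 0 ⊓ rootMfdInfty S

/-- `μ ∈ ℂ` is a proper eigenvalue of `S`. -/
def IsProperEigenvalue (S : LinRel V) (μ : ℂ) : Prop :=
  ker (shift S μ) ≠ ⊥ ∧ ¬ rootMfd S μ ≤ singChains S

/-- `∞` is a proper eigenvalue of `S`. -/
def IsProperEigenvalueInfty (S : LinRel V) : Prop :=
  mul S ≠ ⊥ ∧ ¬ rootMfdInfty S ≤ singChains S

/-- The dimension of the quotient space `X / Y`; it is used for subspaces `Y ≤ X`. -/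
def quotDim (X Y : Submodule ℂ V) : ℕ := Module.finrank ℂ (X ⧸ Y.submoduleOf X)

/-! All sequences below are indexed from `0`: the value at `k` is the term with number `k + 1` of
the usual sequence, which is numbered from `1`. A finite sequence is extended by zeros. -/

/-- `W(μ)`. It is the zero sequence unless `μ` is a proper eigenvalue, see
`weyrW_of_not_proper`; so the family `μ ↦ W(μ)` is the collection of the sequences `W(μ)` of the
finite proper eigenvalues `μ`. -/
def weyrW (S : LinRel V) (μ : ℂ) (k : ℕ) : ℕ :=
  quotDim (ker (iter (shift S μ) (k + 1)) ⊔ singChains S)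
    (ker (iter (shift S μ) k) ⊔ singChains S)

/-- `A`. It is the zero sequence unless `∞` is a proper eigenvalue, see `weyrA_of_not_proper`. -/
def weyrA (S : LinRel V) (k : ℕ) : ℕ :=
  quotDim (mul (iter S (k + 1)) ⊔ singChains S) (mul (iter S k) ⊔ singChains S)

/-- `B`. -/
def weyrB (S : LinRel V) (k : ℕ) : ℕ :=
  quotDim (ker (iter S (k + 1)) ⊓ singChains S) (ker (iter S k) ⊓ singChains S)

/-- `C`. With the usual numbering from `1`, the first term is
`dim (R(S) + dom S) / (R(S) + R_0(S))`, and the term with number `j ≥ 2` is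
`dim (R(S ^ j) + R_0(S)) / (R(S ^ (j + 1)) + R_0(S))`. Thus `C_j` is the number of multi-shift
chains `(x₁, x₂), …, (x_j, x_{j+1})` of length `j`. -/
def weyrC (S : LinRel V) : ℕ → ℕ
  | 0 => quotDim (ran S ⊔ dom S) (ran S ⊔ rootMfd S 0)
  | k + 1 => quotDim (ran (iter S (k + 2)) ⊔ rootMfd S 0) (ran (iter S (k + 3)) ⊔ rootMfd S 0)

theorem quotDim_eq_zero {X Y : Submodule ℂ V} (h : X ≤ Y) : quotDim X Y = 0 := by
  have : Y.submoduleOf X = ⊤ := Submodule.comap_subtype_eq_top.2 h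
  unfold quotDim
  rw [this]
  exact Module.finrank_zero_of_subsingleton

theorem ker_iter_eq_bot {T : LinRel V} (h : ker T = ⊥) (k : ℕ) : ker (iter T k) = ⊥ := by
  induction k with
  | zero =>
    rw [eq_bot_iff]
    intro x hx
    have hx' : (x, (0 : V)) ∈ iter T 0 := hx
    have h0 : (0 : V) = x := hx'
    exact h0.symm
  | succ k ih =>
    rw [eq_bot_iff]
    rintro x ⟨y, h1, h2⟩
    have hy : y ∈ ker T := h2
    rw [h, Submodule.mem_bot] at hy
    subst hy
    have hx : x ∈ ker (iter T k) := h1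
    rwa [ih] at hx

theorem mul_iter_eq_bot {T : LinRel V} (h : mul T = ⊥) (k : ℕ) : mul (iter T k) = ⊥ := by
  induction k with
  | zero =>
    rw [eq_bot_iff]
    intro x hx
    have hx' : ((0 : V), x) ∈ iter T 0 := hx
    have h0 : x = 0 := hx'
    exact h0
  | succ k ih =>
    rw [eq_bot_iff]
    rintro x ⟨y, h1, h2⟩
    have hy : y ∈ mul (iter T k) := h1
    rw [ih, Submodule.mem_bot] at hy
    subst hy
    have hx : x ∈ mul T := h2
    rwa [h] at hx

theorem weyrW_of_not_proper {S : LinRel V} {μ : ℂ} (h : ¬ IsProperEigenvalue S μ) (k : ℕ) :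
    weyrW S μ k = 0 := by
  have hle : ker (iter (shift S μ) (k + 1)) ≤ singChains S := by
    by_cases h1 : ker (shift S μ) = ⊥
    · rw [ker_iter_eq_bot h1]
      exact bot_le
    · have h2 : rootMfd S μ ≤ singChains S := by
        by_contra h2
        exact h ⟨h1, h2⟩
      exact le_trans (le_iSup (fun k : ℕ => ker (iter (shift S μ) k)) (k + 1)) h2
  exact quotDim_eq_zero (sup_le (hle.trans le_sup_right) le_sup_right)

theorem weyrA_of_not_proper {S : LinRel V} (h : ¬ IsProperEigenvalueInfty S) (k : ℕ) :
    weyrA S k = 0 := by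
  have hle : mul (iter S (k + 1)) ≤ singChains S := by
    by_cases h1 : mul S = ⊥
    · rw [mul_iter_eq_bot h1]
      exact bot_le
    · have h2 : rootMfdInfty S ≤ singChains S := by
        by_contra h2
        exact h ⟨h1, h2⟩
      exact le_trans (le_iSup (fun k : ℕ => mul (iter S k)) (k + 1)) h2
  exact quotDim_eq_zero (sup_le (hle.trans le_sup_right) le_sup_right)

end LinRel

/-- The collection `(W, A, B, C)` of a linear relation or `(w, a, b, c)` of a matrix pencil. The
first entry is a family of sequences indexed by complex numbers. -/
@[ext]
structure WeyrChar where
  /-- the sequences of the finite eigenvalues -/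
  w : ℂ → ℕ → ℕ
  /-- the sequence of the eigenvalue `∞` -/
  a : ℕ → ℕ
  /-- the third sequence -/
  b : ℕ → ℕ
  /-- the fourth sequence -/
  c : ℕ → ℕ

/-- The Weyr characteristic `(W, A, B, C)` of a linear relation. -/
def LinRel.weyrChar {V : Type*} [AddCommGroup V] [Module ℂ V] (S : LinRel V) : WeyrChar :=
  ⟨S.weyrW, S.weyrA, S.weyrB, S.weyrC⟩

/-- The absolute value (sum of the entries) of a finite sequence. -/
def seqAbs (a : ℕ → ℕ) : ℕ := ∑ᶠ k, a k

/-- The sum of all entries of a finite family of finite sequences. -/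
def famAbs (w : ℂ → ℕ → ℕ) : ℕ := ∑ᶠ μ, seqAbs (w μ)

/-- The sequence `(d, c₁, c₂, …)`. -/
def seqCons (d : ℕ) (c : ℕ → ℕ) : ℕ → ℕ
  | 0 => d
  | k + 1 => c k

/-! ### Matrix pencils `sE - F` and their Kronecker canonical form -/

/-- The kernel representation `E⁻¹F = {(x, y) | F x = E y}` of the pencil `sE - F`. -/
def kernelRep {n m : ℕ} (E F : Matrix (Fin n) (Fin m) ℂ) : LinRel (Fin m → ℂ) where
  carrier := {p | F.mulVec p.1 = E.mulVec p.2}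
  zero_mem' := by simp
  add_mem' := by
    intro p q hp hq
    simp only [Set.mem_ofPred_eq, Prod.fst_add, Prod.snd_add, Matrix.mulVec_add] at *
    rw [hp, hq]
  smul_mem' := by
    intro c p hp
    simp only [Set.mem_ofPred_eq, Prod.smul_fst, Prod.smul_snd, Matrix.mulVec_smul] at *
    rw [hp]

/-- The four kinds of diagonal blocks `sE - F` in the Kronecker canonical form. -/
inductive KBlock where
  /-- `sI - J`, with `J` the `k × k` Jordan block with eigenvalue `μ` -/
  | fin (μ : ℂ) (k : ℕ)
  /-- `sN - I`, with `N` the `k × k` nilpotent Jordan block with ones below the diagonal -/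
  | inf (k : ℕ)
  /-- `sK - L` of size `(k - 1) × k`, with `K = [I 0]` and `L = [0 I]` -/
  | col (k : ℕ)
  /-- `sKᵀ - Lᵀ` of size `k × (k - 1)`, with `K` and `L` as before -/
  | row (k : ℕ)

namespace KBlock

/-- The number of rows of the block; for `col 1` there are no rows, so that it adds a zero
column. -/
def rows : KBlock → ℕ
  | fin _ k => k
  | inf k => k
  | col k => k - 1
  | row k => k

/-- The number of columns of the block; for `row 1` there are no columns, so that it adds a zero
row. -/
def cols : KBlock → ℕ
  | fin _ k => k
  | inf k => k
  | col k => k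
  | row k => k - 1

/-- The coefficient `E` of the block `sE - F`. -/
def matE : (b : KBlock) → Matrix (Fin b.rows) (Fin b.cols) ℂ
  | fin _ k => (1 : Matrix (Fin k) (Fin k) ℂ)
  | inf k => (Matrix.of fun i j => if i.val = j.val + 1 then 1 else 0 :
      Matrix (Fin k) (Fin k) ℂ)
  | col k => (Matrix.of fun i j => if j.val = i.val then 1 else 0 :
      Matrix (Fin (k - 1)) (Fin k) ℂ)
  | row k => (Matrix.of fun i j => if i.val = j.val then 1 else 0 :
      Matrix (Fin k) (Fin (k - 1)) ℂ)

/-- The coefficient `F` of the block `sE - F`. -/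
def matF : (b : KBlock) → Matrix (Fin b.rows) (Fin b.cols) ℂ
  | fin μ k => (Matrix.of fun i j => if i.val = j.val then μ else
      if j.val = i.val + 1 then 1 else 0 : Matrix (Fin k) (Fin k) ℂ)
  | inf k => (1 : Matrix (Fin k) (Fin k) ℂ)
  | col k => (Matrix.of fun i j => if j.val = i.val + 1 then 1 else 0 :
      Matrix (Fin (k - 1)) (Fin k) ℂ)
  | row k => (Matrix.of fun i j => if i.val = j.val + 1 then 1 else 0 :
      Matrix (Fin k) (Fin (k - 1)) ℂ)

end KBlock

/-- The data of a Kronecker canonical form: the list of the Jordan blocks (eigenvalue and size) of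
the matrix `J₀`, and the multi-indices `α`, `β`, `γ`, all of whose entries are positive. The order
in each list is free, since it changes neither the conjugate partition nor the class under strict
equivalence. -/
structure KroneckerData where
  /-- the Jordan blocks of `J₀` -/
  jordan : List (ℂ × ℕ)
  /-- the sizes of the blocks at infinity -/
  α : List ℕ
  /-- the numbers of columns of the blocks `sK - L` -/
  β : List ℕ
  /-- the numbers of rows of the blocks `sKᵀ - Lᵀ` -/
  γ : List ℕ
  jordan_pos : ∀ p ∈ jordan, 0 < p.2
  α_pos : ∀ k ∈ α, 0 < k
  β_pos : ∀ k ∈ β, 0 < k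
  γ_pos : ∀ k ∈ γ, 0 < k

/-- The conjugate partition of a multi-index: its term with number `k + 1` is the number of
entries that are at least `k + 1`. -/
def conjPart (l : List ℕ) (k : ℕ) : ℕ := l.countP (fun a => k < a)

namespace KroneckerData

/-- The diagonal blocks of the Kronecker canonical form, in order. -/
def blocks (K : KroneckerData) : List KBlock :=
  K.jordan.map (fun p => KBlock.fin p.1 p.2) ++ K.α.map KBlock.inf ++ K.β.map KBlock.col ++
    K.γ.map KBlock.row

/-- The row index set of the Kronecker canonical form. -/
abbrev RowIdx (K : KroneckerData) : Type := (i : Fin K.blocks.length) × Fin (K.blocks.get i).rows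

/-- The column index set of the Kronecker canonical form. -/
abbrev ColIdx (K : KroneckerData) : Type := (i : Fin K.blocks.length) × Fin (K.blocks.get i).cols

/-- The coefficient `E` of the block diagonal pencil `sE - F`. -/
def matE (K : KroneckerData) : Matrix K.RowIdx K.ColIdx ℂ :=
  Matrix.blockDiagonal' fun i => (K.blocks.get i).matE

/-- The coefficient `F` of the block diagonal pencil `sE - F`. -/
def matF (K : KroneckerData) : Matrix K.RowIdx K.ColIdx ℂ :=
  Matrix.blockDiagonal' fun i => (K.blocks.get i).matF

/-- `K` is a Kronecker canonical form of `sE - F`: there are invertible matrices `U` and `V` such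
that `U (sE - F) V` is the pencil of `K`, after an enumeration of the rows and columns of the
latter. -/
def IsFormOf (K : KroneckerData) {n m : ℕ} (E F : Matrix (Fin n) (Fin m) ℂ) : Prop :=
  ∃ (e : K.RowIdx ≃ Fin n) (f : K.ColIdx ≃ Fin m) (U : GL (Fin n) ℂ) (V : GL (Fin m) ℂ),
    U.val * E * V.val = Matrix.reindex e f K.matE ∧
    U.val * F * V.val = Matrix.reindex e f K.matF

/-- The Segre characteristic of `J₀` at `μ`: the sizes of the Jordan blocks with eigenvalue `μ`. -/
def segre (K : KroneckerData) (μ : ℂ) : List ℕ :=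
  (K.jordan.filter fun p => p.1 = μ).map Prod.snd

/-- The conjugate partitions of the Kronecker invariants. -/
def weyrChar (K : KroneckerData) : WeyrChar :=
  ⟨fun μ => conjPart (K.segre μ), conjPart K.α, conjPart K.β, conjPart K.γ⟩

end KroneckerData

/-- `χ` is the Weyr characteristic of the pencil `sE - F`: the pencil has a Kronecker canonical
form, and the conjugate partitions of the invariants of any such form are given by `χ`. -/
def IsPencilWeyrChar {n m : ℕ} (E F : Matrix (Fin n) (Fin m) ℂ) (χ : WeyrChar) : Prop :=
  (∃ K : KroneckerData, K.IsFormOf E F) ∧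
    ∀ K : KroneckerData, K.IsFormOf E F → K.weyrChar = χ

end

/-! The kernel of $(x,y)\mapsto Fx-Ey$ is $S$, so $n\ge 2m-\dim S$ by rank and nullity. Equality
means that this map is onto, and a map onto $\mathbb C^n$ with kernel $S$ exists when $n=2m-\dim S$.
It remains to express this $n$ and the pencil invariants by the Weyr characteristic of $S$.

By Kronecker's theorem (`kronWith_pos`, `exists_isFormOf`) the pencil is a direct sum of canonical
blocks, and its kernel representation is the product of the block relations (`exists_relProd`).
Every subspace entering $W,A,B,C$ is compatible with products, so these sequences are sums over the
blocks. Each block relation is some form of shift, and the subspaces needed are coordinate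
subspaces. Jordan, infinite and $sK-L$ blocks feed only $W$, $A$ and $B$. A block $sK^\top-L^\top$
with $\gamma_i$ rows feeds only $C$, with $\gamma_i-2$ ones: $S$ does not see the first two entries
of $c$ (`IsFormOf.weyrChar_kernelRep`).

If $Fx-Ey$ is onto, no zero row can occur in the canonical form, so all $\gamma_i\ge 2$ and
$c_1=c_2=d$ is the number of $\gamma_i$. Counting columns yields $d$ and counting rows yields $n$.
No separate uniqueness of the canonical form is needed: any form has its invariants determined by
$S$ (`weyrChar_eq`).

Kronecker's theorem is proved by filtering the pair $E,F:X\to Y$ into subpairs whose pieces have one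
kind of block each. The extensions split because the block equations can be solved recursively when
$E$, $F$ or $F-\mu E$ is onto on the subpair (`KronWith.of_extension`). -/

open Module

/-! ### Decompositions of a pair of linear maps into Kronecker blocks -/

namespace KBlock

/-- The index of the block is positive. -/
def Pos : KBlock → Prop
  | fin _ k => 0 < k
  | inf k => 0 < k
  | col k => 0 < k
  | row k => 0 < k

/-! ### Linear combinations along the columns of the block matrices -/

section Action

variable {Y : Type*} [AddCommGroup Y] [Module ℂ Y]

theorem sum_ite_val_eq_smul {k : ℕ} (v : Fin k → Y) (i : Fin k) :
    ∑ r : Fin k, (if r.val = i.val then (1 : ℂ) else 0) • v r = v i := by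
  simp [← Fin.ext_iff, ite_smul]

theorem sum_ite_smul_eq_zero {k : ℕ} (v : Fin k → Y) (p : Fin k → Prop) [DecidablePred p]
    (h : ∀ r, ¬ p r) :
    ∑ r : Fin k, (if p r then (1 : ℂ) else 0) • v r = 0 := by
  simp [h]

theorem sum_matE_row (k : ℕ) (v : Fin (k + 1) → Y) (j : Fin k) :
    ∑ i : Fin (k + 1), (row (k + 1)).matE i j • v i = v j.castSucc :=
  sum_ite_val_eq_smul v j.castSucc

theorem sum_matF_row (k : ℕ) (v : Fin (k + 1) → Y) (j : Fin k) :
    ∑ i : Fin (k + 1), (row (k + 1)).matF i j • v i = v j.succ :=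
  sum_ite_val_eq_smul v j.succ

theorem sum_matE_col_castSucc (k : ℕ) (v : Fin k → Y) (j : Fin k) :
    ∑ i : Fin k, (col (k + 1)).matE i j.castSucc • v i = v j := by
  refine Eq.trans ?_ (sum_ite_val_eq_smul v j)
  exact Finset.sum_congr rfl fun i _ => by simp [matE, eq_comm]

theorem sum_matE_col_last (k : ℕ) (v : Fin k → Y) :
    ∑ i : Fin k, (col (k + 1)).matE i (Fin.last k) • v i = 0 :=
  sum_ite_smul_eq_zero v (fun i => k = i.val) fun i => i.2.ne'

theorem sum_matF_col_succ (k : ℕ) (v : Fin k → Y) (j : Fin k) :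
    ∑ i : Fin k, (col (k + 1)).matF i j.succ • v i = v j := by
  refine Eq.trans ?_ (sum_ite_val_eq_smul v j)
  exact Finset.sum_congr rfl fun i _ => by simp [matF, eq_comm]

theorem sum_matF_col_zero (k : ℕ) (v : Fin k → Y) :
    ∑ i : Fin k, (col (k + 1)).matF i (0 : Fin (k + 1)) • v i = 0 :=
  sum_ite_smul_eq_zero v (fun i => 0 = i.val + 1) fun _ => (Nat.succ_ne_zero _).symm

theorem sum_matE_fin (μ : ℂ) (k : ℕ) (v : Fin k → Y) (j : Fin k) :
    ∑ i : Fin k, (fin μ k).matE i j • v i = v j := by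
  simp [matE, Matrix.one_apply, ite_smul]

theorem sum_matF_fin (μ : ℂ) (k : ℕ) (v : Fin k → Y) (j : Fin k) :
    ∑ i : Fin k, (fin μ k).matF i j • v i =
      μ • v j + ∑ i : Fin k, (if j.val = i.val + 1 then (1 : ℂ) else 0) • v i := by
  have h : ∀ i : Fin k, (fin μ k).matF i j • v i = (if i.val = j.val then (1 : ℂ) else 0) • (μ • v i)
      + (if j.val = i.val + 1 then (1 : ℂ) else 0) • v i := by
    intro i
    by_cases h1 : i.val = j.val
    · have h2 : ¬ j.val = i.val + 1 := by omega
      simp [matF, h1]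
    · simp [matF, h1]
  rw [Finset.sum_congr rfl fun i _ => h i, Finset.sum_add_distrib,
    sum_ite_val_eq_smul (fun i => μ • v i) j]

theorem sum_matF_fin_zero (μ : ℂ) (k : ℕ) (v : Fin (k + 1) → Y) :
    ∑ i : Fin (k + 1), (fin μ (k + 1)).matF i (0 : Fin (k + 1)) • v i = μ • v 0 := by
  refine (sum_matF_fin μ (k + 1) v 0).trans ?_
  rw [sum_ite_smul_eq_zero v _ (fun i => ?_), add_zero]
  simp

theorem sum_matF_fin_succ (μ : ℂ) (k : ℕ) (v : Fin (k + 1) → Y) (j : Fin k) :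
    ∑ i : Fin (k + 1), (fin μ (k + 1)).matF i j.succ • v i = μ • v j.succ + v j.castSucc := by
  refine (sum_matF_fin μ (k + 1) v j.succ).trans (congrArg _ ?_)
  refine Eq.trans ?_ (sum_ite_val_eq_smul v j.castSucc)
  exact Finset.sum_congr rfl fun i _ => by simp [eq_comm]

theorem sum_matF_inf (k : ℕ) (v : Fin k → Y) (j : Fin k) :
    ∑ i : Fin k, (inf k).matF i j • v i = v j := by
  simp [matF, Matrix.one_apply, ite_smul]

theorem sum_matE_inf_castSucc (k : ℕ) (v : Fin (k + 1) → Y) (j : Fin k) :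
    ∑ i : Fin (k + 1), (inf (k + 1)).matE i j.castSucc • v i = v j.succ :=
  sum_ite_val_eq_smul v j.succ

theorem sum_matE_inf_last (k : ℕ) (v : Fin (k + 1) → Y) :
    ∑ i : Fin (k + 1), (inf (k + 1)).matE i (Fin.last k) • v i = 0 :=
  sum_ite_smul_eq_zero v (fun i => i.val = k + 1) fun i => i.2.ne

end Action

end KBlock

universe u v

/-! ### Block decompositions and splitting of extensions -/

section Kron

variable {X : Type u} {Y : Type v} [AddCommGroup X] [Module ℂ X] [AddCommGroup Y] [Module ℂ Y]

/-- The pair `E, F : X → Y` is a direct sum of Kronecker blocks, all of which satisfy `P`. -/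
def KronWith (P : KBlock → Prop) (E F : X →ₗ[ℂ] Y) : Prop :=
  ∃ (ι : Type) (_ : Fintype ι) (b : ι → KBlock) (p : Basis ((i : ι) × Fin (b i).cols) ℂ X)
    (q : Basis ((i : ι) × Fin (b i).rows) ℂ Y), ∀ i, P (b i) ∧ ∀ j,
      E (p ⟨i, j⟩) = ∑ r, (b i).matE r j • q ⟨i, r⟩ ∧
      F (p ⟨i, j⟩) = ∑ r, (b i).matF r j • q ⟨i, r⟩

theorem KronWith.mono {P Q : KBlock → Prop} {E F : X →ₗ[ℂ] Y} (h : KronWith P E F)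
    (hPQ : ∀ b, P b → Q b) : KronWith Q E F := by
  obtain ⟨ι, hι, b, p, q, h⟩ := h
  exact ⟨ι, hι, b, p, q, fun i => ⟨hPQ _ (h i).1, (h i).2⟩⟩

theorem KronWith.congr {X' Y' : Type*} [AddCommGroup X'] [Module ℂ X'] [AddCommGroup Y']
    [Module ℂ Y'] {P : KBlock → Prop} {E F : X →ₗ[ℂ] Y} (h : KronWith P E F)
    {E' F' : X' →ₗ[ℂ] Y'} (e : X ≃ₗ[ℂ] X') (f : Y ≃ₗ[ℂ] Y') (hE : ∀ x, E' (e x) = f (E x))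
    (hF : ∀ x, F' (e x) = f (F x)) : KronWith P E' F' := by
  obtain ⟨ι, hι, b, p, q, h⟩ := h
  refine ⟨ι, hι, b, p.map e, q.map f, fun i => ⟨(h i).1, fun j => ⟨?_, ?_⟩⟩⟩
  · simp [hE, ((h i).2 j).1]
  · simp [hF, ((h i).2 j).2]

/-- Every extension of the block `b` by the pair `E, F` splits. -/
def ExtVanish (b : KBlock) (E F : X →ₗ[ℂ] Y) : Prop :=
  ∀ dE dF : Fin b.cols → Y, ∃ (r : Fin b.cols → X) (s : Fin b.rows → Y), ∀ j,
    E (r j) = dE j + ∑ i, b.matE i j • s i ∧ F (r j) = dF j + ∑ i, b.matF i j • s i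

/-- The lift `v` is left arbitrary, so that lifts corrected by elements of `W` can be used to split
extensions. -/
theorem exists_basis_sum_of_quotient {W : Submodule ℂ X} {m n : Type*} (bW : Basis m ℂ W)
    (bQ : Basis n ℂ (X ⧸ W)) (v : n → X) (hv : ∀ j, W.mkQ (v j) = bQ j) :
    ∃ B : Basis (m ⊕ n) ℂ X, (∀ i, B (Sum.inl i) = bW i) ∧ ∀ j, B (Sum.inr j) = v j := by
  have hvQ : W.mkQ ∘ v = bQ := funext hv
  refine ⟨Basis.mk (v := Sum.elim (fun i => (bW i : X)) v) ?_ ?_,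
    fun i => Basis.mk_apply _ _ _, fun j => Basis.mk_apply _ _ _⟩
  · refine LinearIndependent.sumElim_of_quotient bW.linearIndependent v ?_
    have : LinearIndependent ℂ (W.mkQ ∘ v) := hvQ ▸ bQ.linearIndependent
    exact this
  · have h1 : Set.range (fun i ↦ (bW i : X)) = W.subtype '' (Set.range (fun i ↦ bW i)) := by
      ext x; simp
    rw [Set.Sum.elim_range, Submodule.span_union, h1,
      ← Submodule.map_span, bW.span_eq, Submodule.map_top, Submodule.range_subtype, top_le_iff,
      ← Submodule.map_mkQ_eq_top, Submodule.map_span, ← Set.range_comp, hvQ, bQ.span_eq]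

theorem exists_basis_sigma_sum {ι₁ ι₂ : Type*} (d : ι₁ ⊕ ι₂ → ℕ)
    (B : Basis (((i : ι₁) × Fin (d (Sum.inl i))) ⊕ ((i : ι₂) × Fin (d (Sum.inr i)))) ℂ X) :
    ∃ B' : Basis ((i : ι₁ ⊕ ι₂) × Fin (d i)) ℂ X,
      (∀ i j, B' ⟨Sum.inl i, j⟩ = B (Sum.inl ⟨i, j⟩)) ∧
      ∀ i j, B' ⟨Sum.inr i, j⟩ = B (Sum.inr ⟨i, j⟩) :=
  ⟨B.reindex (Equiv.sumSigmaDistrib fun i => Fin (d i)).symm,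
    fun _ _ => Basis.reindex_apply _ _ _, fun _ _ => Basis.reindex_apply _ _ _⟩

/-- Arbitrary lifts of the quotient bases satisfy the block relations up to defects in `Y₁`.
`ExtVanish` supplies corrections inside `X₁` and `Y₁` that remove the defects, so the blocks of the
quotient reappear as a complement of the subpair. -/
theorem KronWith.of_extension {P Q : KBlock → Prop} {E F : X →ₗ[ℂ] Y} {X₁ : Submodule ℂ X}
    {Y₁ : Submodule ℂ Y} (hE : X₁ ≤ Y₁.comap E) (hF : X₁ ≤ Y₁.comap F)
    (h₁ : KronWith P (E.restrict hE) (F.restrict hF))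
    (h₂ : KronWith Q (X₁.mapQ Y₁ E hE) (X₁.mapQ Y₁ F hF)) (hQP : ∀ b, Q b → P b)
    (hext : ∀ b, Q b → ExtVanish b (E.restrict hE) (F.restrict hF)) : KronWith P E F := by
  obtain ⟨ι₁, hι₁, b₁, p₁, q₁, h₁⟩ := h₁
  obtain ⟨ι₂, hι₂, b₂, p₂, q₂, h₂⟩ := h₂
  choose x hx using fun k => X₁.mkQ_surjective (p₂ k)
  choose y hy using fun k => Y₁.mkQ_surjective (q₂ k)
  have hdE : ∀ i j, E (x ⟨i, j⟩) - ∑ r, (b₂ i).matE r j • y ⟨i, r⟩ ∈ Y₁ := by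
    intro i j
    rw [← Submodule.Quotient.mk_eq_zero, ← Submodule.mkQ_apply, map_sub, map_sum, sub_eq_zero]
    simp_rw [map_smul, hy]
    rw [← ((h₂ i).2 j).1, ← hx]
    rfl
  have hdF : ∀ i j, F (x ⟨i, j⟩) - ∑ r, (b₂ i).matF r j • y ⟨i, r⟩ ∈ Y₁ := by
    intro i j
    rw [← Submodule.Quotient.mk_eq_zero, ← Submodule.mkQ_apply, map_sub, map_sum, sub_eq_zero]
    simp_rw [map_smul, hy]
    rw [← ((h₂ i).2 j).2, ← hx]
    rfl
  choose r s hrs using fun i => hext (b₂ i) (h₂ i).1 (fun j => ⟨_, hdE i j⟩) (fun j => ⟨_, hdF i j⟩)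
  -- With defect $d=Ex-\sum e\,y$ and $Er=d+\sum e\,s$, the corrected lifts satisfy $E(x-r)=\sum
  -- e\,(y-s)$ exactly; likewise for `F`.
  obtain ⟨p, hp₁, hp₂⟩ := exists_basis_sum_of_quotient p₁ p₂ (fun k => x k - r k.1 k.2)
    (fun k => by
      rw [map_sub, hx, sub_eq_self, Submodule.mkQ_apply, Submodule.Quotient.mk_eq_zero]
      exact (r k.1 k.2).2)
  obtain ⟨q, hq₁, hq₂⟩ := exists_basis_sum_of_quotient q₁ q₂ (fun k => y k - s k.1 k.2)
    (fun k => by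
      rw [map_sub, hy, sub_eq_self, Submodule.mkQ_apply, Submodule.Quotient.mk_eq_zero]
      exact (s k.1 k.2).2)
  obtain ⟨p', hp₁', hp₂'⟩ := exists_basis_sigma_sum (fun i => (Sum.elim b₁ b₂ i).cols) p
  obtain ⟨q', hq₁', hq₂'⟩ := exists_basis_sigma_sum (fun i => (Sum.elim b₁ b₂ i).rows) q
  refine ⟨ι₁ ⊕ ι₂, inferInstance, Sum.elim b₁ b₂, p', q', ?_⟩
  rintro (i | i)
  · refine ⟨(h₁ i).1, fun j => ?_⟩
    have h := (h₁ i).2 j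
    constructor
    · refine (congrArg E ((hp₁' i j).trans (hp₁ ⟨i, j⟩))).trans ((congrArg Subtype.val h.1).trans ?_)
      rw [AddSubmonoidClass.coe_finsetSum]
      exact Finset.sum_congr rfl fun k _ => congrArg _ ((hq₁' i k).trans (hq₁ ⟨i, k⟩)).symm
    · refine (congrArg F ((hp₁' i j).trans (hp₁ ⟨i, j⟩))).trans ((congrArg Subtype.val h.2).trans ?_)
      rw [AddSubmonoidClass.coe_finsetSum]
      exact Finset.sum_congr rfl fun k _ => congrArg _ ((hq₁' i k).trans (hq₁ ⟨i, k⟩)).symm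
  · refine ⟨hQP _ (h₂ i).1, fun j => ?_⟩
    have h := hrs i j
    constructor
    · refine (congrArg E ((hp₂' i j).trans (hp₂ ⟨i, j⟩))).trans ?_
      have h' := congrArg Subtype.val h.1
      simp only [LinearMap.coe_restrict_apply, Submodule.coe_add, AddSubmonoidClass.coe_finsetSum,
        Submodule.coe_smul] at h'
      rw [map_sub, h', sub_add_eq_sub_sub, sub_sub_cancel, ← Finset.sum_sub_distrib]
      exact Finset.sum_congr rfl fun k _ => (smul_sub _ _ _).symm.trans
        (congrArg _ ((hq₂' i k).trans (hq₂ ⟨i, k⟩)).symm)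
    · refine (congrArg F ((hp₂' i j).trans (hp₂ ⟨i, j⟩))).trans ?_
      have h' := congrArg Subtype.val h.2
      simp only [LinearMap.coe_restrict_apply, Submodule.coe_add, AddSubmonoidClass.coe_finsetSum,
        Submodule.coe_smul] at h'
      rw [map_sub, h', sub_add_eq_sub_sub, sub_sub_cancel, ← Finset.sum_sub_distrib]
      exact Finset.sum_congr rfl fun k _ => (smul_sub _ _ _).symm.trans
        (congrArg _ ((hq₂' i k).trans (hq₂ ⟨i, k⟩)).symm)

/-- All splitting problems for chains reduce to this recursion. -/
theorem exists_seq_of_surjective {G : X →ₗ[ℂ] Y} (hG : Function.Surjective G) (A : X →ₗ[ℂ] Y)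
    (d : ℕ → Y) : ∃ r : ℕ → X, G (r 0) = d 0 ∧ ∀ n, G (r (n + 1)) = d (n + 1) + A (r n) := by
  choose g hg using hG
  exact ⟨fun n => Nat.rec (g (d 0)) (fun n x => g (d (n + 1) + A x)) n, hg _, fun n => hg _⟩

/-- The `E`-part of the block is the identity, which forces $s=Er-d_E$. Substitution leaves $(F-\mu
E)r_{j+1}=d_F-\mu d_E-(d_E)_j+Er_j$, with $d_E,d_F$ taken at $j+1$, to be solved upwards in $j$. -/
theorem extVanish_fin {E F : X →ₗ[ℂ] Y} (μ : ℂ) (k : ℕ)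
    (h : Function.Surjective (F - μ • E)) : ExtVanish (KBlock.fin μ (k + 1)) E F := by
  intro (dE : Fin (k + 1) → Y) (dF : Fin (k + 1) → Y)
  obtain ⟨r, hr0, hr⟩ := exists_seq_of_surjective h E
    -- Index 0 has no predecessor; the values for $n>k$ are never used.
    (fun n => if h : n < k + 1 then dF ⟨n, h⟩ - μ • dE ⟨n, h⟩ -
      (if h' : 0 < n then dE ⟨n - 1, by omega⟩ else 0) else 0)
  refine ⟨fun j => r j.val, fun j => E (r j.val) - dE j, fun (j : Fin (k + 1)) => ⟨?_, ?_⟩⟩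
  · refine Eq.trans ?_ (congrArg _ (KBlock.sum_matE_fin μ (k + 1) _ j).symm)
    exact (add_sub_cancel _ _).symm
  · refine Fin.cases ?_ (fun j => ?_) j
    · refine Eq.trans ?_ (congrArg _ (KBlock.sum_matF_fin_zero μ k _).symm)
      simp only [LinearMap.sub_apply, LinearMap.smul_apply, lt_self_iff_false, dite_false,
        Nat.zero_lt_succ, dite_true, sub_zero] at hr0
      rw [sub_eq_iff_eq_add] at hr0
      simp only [Fin.val_zero, smul_sub, hr0]
      rw [show (⟨0, Nat.zero_lt_succ k⟩ : Fin (k + 1)) = 0 from rfl]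
      abel
    · refine Eq.trans ?_ (congrArg _ (KBlock.sum_matF_fin_succ μ k _ j).symm)
      have h1 := hr j.val
      have hj := j.2
      simp only [LinearMap.sub_apply, LinearMap.smul_apply, Nat.zero_lt_succ, dite_true,
        Nat.add_lt_add_iff_right, hj, Nat.add_sub_cancel] at h1
      rw [sub_eq_iff_eq_add] at h1
      simp only [Fin.val_succ, Fin.val_castSucc, smul_sub, h1]
      rw [show (⟨j.val + 1, Nat.succ_lt_succ hj⟩ : Fin (k + 1)) = j.succ from rfl,
        show (⟨j.val, Nat.lt_succ_of_lt hj⟩ : Fin (k + 1)) = j.castSucc from rfl]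
      abel

/-- Here the `F`-part is the identity, so $s=Fr-d_F$ and $Er_j=(d_E)_j+s_{j+1}$. The last equation
has no $s$-term, so the recursion runs downwards, hence `Fin.rev`. -/
theorem extVanish_inf {E F : X →ₗ[ℂ] Y} (k : ℕ) (h : Function.Surjective E) :
    ExtVanish (KBlock.inf (k + 1)) E F := by
  intro (dE : Fin (k + 1) → Y) (dF : Fin (k + 1) → Y)
  obtain ⟨r, hr0, hr⟩ := exists_seq_of_surjective h F
    (fun n => if h : n < k + 1 then dE (Fin.rev ⟨n, h⟩) -
      (if h' : 0 < n then dF (Fin.rev ⟨n - 1, by omega⟩) else 0) else 0)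
  refine ⟨fun j => r j.rev.val, fun j => F (r j.rev.val) - dF j, fun (j : Fin (k + 1)) => ⟨?_, ?_⟩⟩
  · refine Fin.lastCases ?_ (fun j => ?_) j
    · refine Eq.trans ?_ (congrArg _ (KBlock.sum_matE_inf_last k _).symm)
      simp only [lt_self_iff_false, dite_false, Nat.zero_lt_succ, dite_true, sub_zero] at hr0
      change E (r (Fin.rev (Fin.last k)).val) = _
      rw [Fin.rev_last, Fin.val_zero, hr0, add_zero,
        show (⟨0, Nat.zero_lt_succ k⟩ : Fin (k + 1)) = 0 from rfl, Fin.rev_zero]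
    · refine Eq.trans ?_ (congrArg _ (KBlock.sum_matE_inf_castSucc k _ j).symm)
      have h1 := hr j.rev.val
      have hj := j.rev.2
      simp only [Nat.zero_lt_succ, dite_true, Nat.add_lt_add_iff_right, hj,
        Nat.add_sub_cancel] at h1
      rw [show (⟨j.rev.val + 1, Nat.succ_lt_succ hj⟩ : Fin (k + 1)) = j.rev.succ from rfl,
        show (⟨j.rev.val, Nat.lt_succ_of_lt hj⟩ : Fin (k + 1)) = j.rev.castSucc from rfl,
        Fin.rev_succ, Fin.rev_castSucc, Fin.rev_rev] at h1
      change E (r (Fin.rev j.castSucc).val) = _ + (F (r (Fin.rev j.succ).val) - _)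
      rw [Fin.rev_castSucc, Fin.rev_succ, Fin.val_succ, Fin.val_castSucc, h1]
      abel
  · refine Eq.trans ?_ (congrArg _ (KBlock.sum_matF_inf (k + 1) _ j).symm)
    exact (add_sub_cancel _ _).symm

/-- The equations are $Er_j=(d_E)_j+s_j$ and $Fr_j=(d_F)_j+s_{j+1}$. The second determines
$s_{j+1}$, the value $s_0=0$ is a free choice, and the first is then a recursion for $r$. -/
theorem extVanish_row_of_surjective_left {E F : X →ₗ[ℂ] Y} (k : ℕ) (h : Function.Surjective E) :
    ExtVanish (KBlock.row (k + 1)) E F := by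
  intro (dE : Fin k → Y) (dF : Fin k → Y)
  obtain ⟨r, hr0, hr⟩ := exists_seq_of_surjective h F
    (fun n => (if h : n < k then dE ⟨n, h⟩ else 0) -
      (if h : 0 < n ∧ n < k + 1 then dF ⟨n - 1, by omega⟩ else 0))
  refine ⟨fun j => r j.val, Fin.cases 0 fun j => F (r j.val) - dF j, fun (j : Fin k) => ⟨?_, ?_⟩⟩
  · refine Eq.trans ?_ (congrArg _ (KBlock.sum_matE_row k _ j).symm)
    obtain ⟨j, hj⟩ := j
    cases j with
    | zero => simpa [hj] using hr0
    | succ j =>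
      have h1 := hr j
      simp only [hj, dite_true, Nat.zero_lt_succ, true_and, Nat.lt_succ_of_lt hj,
        Nat.add_sub_cancel] at h1
      change E (r (j + 1)) = dE ⟨j + 1, hj⟩ + (F (r j) - dF ⟨j, _⟩)
      rw [h1]
      abel
  · refine Eq.trans ?_ (congrArg _ (KBlock.sum_matF_row k _ j).symm)
    exact (add_sub_cancel _ _).symm

/-- Reversing the chain exchanges `E` and `F`. -/
theorem extVanish_row_of_surjective_right {E F : X →ₗ[ℂ] Y} (k : ℕ) (h : Function.Surjective F) :
    ExtVanish (KBlock.row (k + 1)) E F := by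
  intro (dE : Fin k → Y) (dF : Fin k → Y)
  obtain ⟨r, s, hrs⟩ := extVanish_row_of_surjective_left k h (F := E)
    (fun j : Fin k => dF j.rev) (fun j : Fin k => dE j.rev)
  refine ⟨fun j => r (Fin.rev (n := k) j), fun j => s (Fin.rev (n := k + 1) j),
    fun (j : Fin k) => ⟨?_, ?_⟩⟩
  · refine ((hrs j.rev).2.trans (congrArg _ (KBlock.sum_matF_row k _ j.rev))).trans ?_
    refine Eq.trans ?_ (congrArg _ (KBlock.sum_matE_row k _ j).symm)
    simp only [Fin.rev_rev]
    rw [← Fin.rev_castSucc]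
  · refine ((hrs j.rev).1.trans (congrArg _ (KBlock.sum_matE_row k _ j.rev))).trans ?_
    refine Eq.trans ?_ (congrArg _ (KBlock.sum_matF_row k _ j).symm)
    simp only [Fin.rev_rev]
    rw [← Fin.rev_succ]

end Kron



/-! ### Blocks `sKᵀ - Lᵀ` and, by duality, blocks `sK - L` -/

section RowDecomp

variable {X : Type u} {Y : Type v} [AddCommGroup X] [Module ℂ X] [AddCommGroup Y] [Module ℂ Y]

/-- The pair `E, F : X → Y` is a direct sum of blocks `sKᵀ - Lᵀ`. -/
def RowDecomp (E F : X →ₗ[ℂ] Y) : Prop :=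
  ∃ (ι : Type) (_ : Fintype ι) (K : ι → ℕ) (p : Basis ((i : ι) × Fin (K i)) ℂ X)
    (q : Basis ((i : ι) × Fin (K i + 1)) ℂ Y), ∀ i j,
      E (p ⟨i, j⟩) = q ⟨i, j.castSucc⟩ ∧ F (p ⟨i, j⟩) = q ⟨i, j.succ⟩

theorem RowDecomp.kronWith {E F : X →ₗ[ℂ] Y} (h : RowDecomp E F) :
    KronWith (fun b => ∃ k, b = KBlock.row (k + 1)) E F := by
  obtain ⟨ι, hι, K, p, q, h⟩ := h
  refine ⟨ι, hι, fun i => KBlock.row (K i + 1), p, q, fun i => ⟨⟨_, rfl⟩, fun (j : Fin (K i)) =>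
    ⟨?_, ?_⟩⟩⟩
  · exact (h i j).1.trans (KBlock.sum_matE_row (K i) (fun r => q ⟨i, r⟩) j).symm
  · exact (h i j).2.trans (KBlock.sum_matF_row (K i) (fun r => q ⟨i, r⟩) j).symm

theorem RowDecomp.swap {E F : X →ₗ[ℂ] Y} (h : RowDecomp F E) : RowDecomp E F := by
  obtain ⟨ι, hι, K, p, q, h⟩ := h
  refine ⟨ι, hι, K, p.reindex (Equiv.sigmaCongrRight fun _ => Fin.revPerm),
    q.reindex (Equiv.sigmaCongrRight fun _ => Fin.revPerm), fun i j => ?_⟩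
  have h1 := h i j.rev
  simp only [Basis.reindex_apply, Equiv.sigmaCongrRight_symm, Equiv.sigmaCongrRight_apply,
    Fin.revPerm_symm, Fin.revPerm_apply, Fin.rev_castSucc, Fin.rev_succ]
  exact h1.symm

theorem exists_predual_basis [FiniteDimensional ℂ X] {κ : Type*} [Finite κ] [DecidableEq κ]
    (b : Basis κ ℂ (Dual ℂ X)) :
    ∃ b' : Basis κ ℂ X, ∀ i j, b i (b' j) = if i = j then 1 else 0 := by
  refine ⟨b.dualBasis.map (evalEquiv ℂ X).symm, fun i j => ?_⟩
  rw [Basis.map_apply, apply_evalEquiv_symm_apply, Basis.dualBasis_apply_self]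

/-- The transpose of a block `sKᵀ - Lᵀ` is a block `sK - L`; the predual bases carry out the
transposition. -/
theorem RowDecomp.kronWith_of_dual {E F : X →ₗ[ℂ] Y} [FiniteDimensional ℂ X]
    [FiniteDimensional ℂ Y] (h : RowDecomp E.dualMap F.dualMap) :
    KronWith (fun b => ∃ k, b = KBlock.col (k + 1)) E F := by
  classical
  obtain ⟨ι, hι, K, p, q, h⟩ := h
  obtain ⟨q', hq'⟩ := exists_predual_basis q
  obtain ⟨p', hp'⟩ := exists_predual_basis p
  have hext : ∀ y z : Y, (∀ k, p k y = p k z) → y = z := by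
    intro y z hyz
    have h1 : evalEquiv ℂ Y y = evalEquiv ℂ Y z := p.ext fun k => hyz k
    exact (evalEquiv ℂ Y).injective h1
  have hE : ∀ k i j, p k (E (q' ⟨i, j⟩)) = if (⟨k.1, k.2.castSucc⟩ : (i : ι) × Fin (K i + 1)) =
      ⟨i, j⟩ then 1 else 0 := fun k i j =>
    (LinearMap.congr_fun (h k.1 k.2).1 (q' ⟨i, j⟩)).trans (hq' _ _)
  have hF : ∀ k i j, p k (F (q' ⟨i, j⟩)) = if (⟨k.1, k.2.succ⟩ : (i : ι) × Fin (K i + 1)) =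
      ⟨i, j⟩ then 1 else 0 := fun k i j =>
    (LinearMap.congr_fun (h k.1 k.2).2 (q' ⟨i, j⟩)).trans (hq' _ _)
  have hE_last : ∀ i, E (q' ⟨i, Fin.last (K i)⟩) = 0 := by
    refine fun i => hext _ _ fun k => ?_
    rw [hE, if_neg, map_zero]
    intro h2
    obtain ⟨rfl, h2⟩ := Sigma.mk.inj_iff.1 h2
    exact (Fin.castSucc_ne_last _) (eq_of_heq h2)
  have hE_castSucc : ∀ i (j : Fin (K i)), E (q' ⟨i, j.castSucc⟩) = p' ⟨i, j⟩ := by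
    rintro i j
    refine hext _ _ fun ⟨i', j'⟩ => ?_
    rw [hE, hp']
    congr 1
    simp only [Sigma.mk.inj_iff, eq_iff_iff]
    refine and_congr_right ?_
    rintro rfl
    simp
  have hF_zero : ∀ i, F (q' ⟨i, 0⟩) = 0 := by
    refine fun i => hext _ _ fun k => ?_
    rw [hF, if_neg, map_zero]
    intro h2
    obtain ⟨rfl, h2⟩ := Sigma.mk.inj_iff.1 h2
    exact (Fin.succ_ne_zero _) (eq_of_heq h2)
  have hF_succ : ∀ i (j : Fin (K i)), F (q' ⟨i, j.succ⟩) = p' ⟨i, j⟩ := by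
    rintro i j
    refine hext _ _ fun ⟨i', j'⟩ => ?_
    rw [hF, hp']
    congr 1
    simp only [Sigma.mk.inj_iff, eq_iff_iff]
    refine and_congr_right ?_
    rintro rfl
    simp
  refine ⟨ι, hι, fun i => KBlock.col (K i + 1), q', p', fun i => ⟨⟨_, rfl⟩,
    fun (j : Fin (K i + 1)) => ⟨?_, ?_⟩⟩⟩
  · refine Fin.lastCases ?_ (fun j => ?_) j
    · exact (hE_last i).trans (KBlock.sum_matE_col_last (K i) (fun r => p' ⟨i, r⟩)).symm
    · exact (hE_castSucc i j).trans
        (KBlock.sum_matE_col_castSucc (K i) (fun r => p' ⟨i, r⟩) j).symm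
  · refine Fin.cases ?_ (fun j => ?_) j
    · exact (hF_zero i).trans (KBlock.sum_matF_col_zero (K i) (fun r => p' ⟨i, r⟩)).symm
    · exact (hF_succ i j).trans (KBlock.sum_matF_col_succ (K i) (fun r => p' ⟨i, r⟩) j).symm

theorem exists_basis_sum_of_linearIndependent [FiniteDimensional ℂ Y] {κ : Type*} {v : κ → Y}
    (hv : LinearIndependent ℂ v) :
    ∃ (t : ℕ) (B : Basis (κ ⊕ Fin t) ℂ Y), ∀ k, B (Sum.inl k) = v k := by
  let W := Submodule.span ℂ (Set.range v)
  let bQ := finBasis ℂ (Y ⧸ W)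
  choose w hw using fun j => W.mkQ_surjective (bQ j)
  obtain ⟨B, hB, -⟩ := exists_basis_sum_of_quotient (Basis.span hv) bQ w hw
  exact ⟨_, B, fun k => (hB k).trans (by rw [Basis.span_apply])⟩

end RowDecomp

/-- The pair `E, F` is a direct sum of blocks `sKᵀ - Lᵀ` if `F` is injective and no nonzero
subspace satisfies `E U ≤ F U`. -/
theorem rowDecomp_of_injective (n : ℕ) : ∀ {X Y : Type u} [AddCommGroup X] [Module ℂ X]
    [AddCommGroup Y] [Module ℂ Y] [FiniteDimensional ℂ X] [FiniteDimensional ℂ Y]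
    {E F : X →ₗ[ℂ] Y}, finrank ℂ X = n → Function.Injective F →
    (∀ U : Submodule ℂ X, U.map E ≤ U.map F → U = ⊥) → RowDecomp E F := by
  induction n using Nat.strong_induction_on with
  | _ n ih =>
  intro X Y _ _ _ _ _ _ E F hn hF hU
  let e (t : ℕ) : ((_ : Fin t) × Fin (0 + 1)) ≃ Fin t :=
    @Equiv.sigmaUnique (Fin t) (fun _ => Fin 1) fun _ => inferInstance
  rcases Nat.eq_zero_or_pos n with h0 | h0
  -- With `X = 0` each basis vector of `Y` is a block with one row and no columns.
  · have : Subsingleton X := finrank_zero_iff.1 (hn.trans h0)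
    have : IsEmpty ((_ : Fin (finrank ℂ Y)) × Fin 0) := ⟨fun k => k.2.elim0⟩
    exact ⟨Fin (finrank ℂ Y), inferInstance, fun _ => 0, (Basis.empty X :
      Basis ((_ : Fin (finrank ℂ Y)) × Fin 0) ℂ X), (finBasis ℂ Y).reindex
        (e _).symm, fun _ j => j.elim0⟩
  -- Induction is applied to the pair $F^{-1}E$, inclusion $:X'\to X$, which inherits the
  -- hypotheses. A chain $q_0,\dots,q_K$ of it in `X` satisfies $Eq_{j+1}=Fq_j$.
  let X' : Submodule ℂ X := (LinearMap.range F).comap E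
  let g : X' →ₗ[ℂ] X := (LinearEquiv.ofInjective F hF).symm.toLinearMap ∘ₗ
    E.restrict (p := X') (q := LinearMap.range F) fun _ hx => hx
  have hg : ∀ x, F (g x) = E x := fun x => congrArg Subtype.val
    ((LinearEquiv.ofInjective F hF).apply_symm_apply
      (E.restrict (p := X') (q := LinearMap.range F) (fun _ hx => hx) x))
  have hlt : finrank ℂ X' < n := by
    rw [← hn]
    refine Submodule.finrank_lt fun htop => ?_
    have h1 := hU ⊤ (by
      rintro _ ⟨x, -, rfl⟩
      have : x ∈ X' := htop ▸ Submodule.mem_top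
      obtain ⟨z, hz⟩ := this
      exact ⟨z, trivial, hz⟩)
    have h2 : Subsingleton X := (Submodule.subsingleton_iff ℂ).1 (subsingleton_of_bot_eq_top h1.symm)
    rw [finrank_zero_of_subsingleton] at hn
    omega
  obtain ⟨ι, hι, K, p, q, h⟩ := ih _ hlt (E := g) (F := X'.subtype) rfl X'.injective_subtype (by
    intro U hUg
    have h1 := hU (U.map X'.subtype) (by
      rw [← Submodule.map_comp]
      rintro _ ⟨x, hx, rfl⟩
      refine ⟨g x, hUg ⟨x, hx, rfl⟩, hg x⟩)
    exact Submodule.map_injective_of_injective X'.injective_subtype (h1.trans (Submodule.map_bot _).symm))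
  classical
  -- Each chain of `X` yields the chain $Eq_0,\ Fq_0=Eq_1,\ \dots,\ Fq_K$ of `Y`, which is longer by
  -- one.
  let w : ((i : ι) × Fin (K i + 1 + 1)) → Y := fun k =>
    Fin.cases (motive := fun _ => Y) (E (q ⟨k.1, 0⟩)) (fun j => F (q ⟨k.1, j⟩)) k.2
  have hw : LinearIndependent ℂ w := by
    rw [Fintype.linearIndependent_iff]
    intro c hc
    rw [Fintype.sum_sigma] at hc
    simp only [Fin.sum_univ_succ (n := _ + 1), w, Fin.cases_zero, Fin.cases_succ,
      Finset.sum_add_distrib] at hc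
    have hcE : ∑ i, c ⟨i, 0⟩ • E (q ⟨i, 0⟩) = E (∑ i, c ⟨i, 0⟩ • q ⟨i, 0⟩) := by simp
    have hcF : ∑ i, ∑ j : Fin (K i + 1), c ⟨i, j.succ⟩ • F (q ⟨i, j⟩) =
        F (∑ k : (i : ι) × Fin (K i + 1), c ⟨k.1, k.2.succ⟩ • q k) := by
      simp [Fintype.sum_sigma]
    rw [hcE, hcF] at hc
    -- A relation among the `w` puts $E\sum c_{i,0}q_{i,0}$ into the range of `F`. But `X'` is
    -- spanned by the $q_{i,j+1}$, so all $c_{i,0}$ vanish; injectivity of `F` does the rest.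
    have hmem : ∑ i, c ⟨i, 0⟩ • q ⟨i, 0⟩ ∈ X' :=
      ⟨-(∑ k : (i : ι) × Fin (K i + 1), c ⟨k.1, k.2.succ⟩ • q k), by
        rw [map_neg]; exact (eq_neg_of_add_eq_zero_left hc).symm⟩
    have hzero : ∀ i, ∀ x : X', q.coord ⟨i, 0⟩ x = 0 := by
      intro i x
      have : q.coord ⟨i, 0⟩ ∘ₗ X'.subtype = 0 := by
        refine p.ext fun k => ?_
        rw [LinearMap.comp_apply, (h k.1 k.2).2, Basis.coord_apply, Basis.repr_self,
          Finsupp.single_apply, if_neg, LinearMap.zero_apply]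
        intro h2
        obtain ⟨rfl, h2⟩ := Sigma.mk.inj_iff.1 h2
        exact (Fin.succ_ne_zero _) (eq_of_heq h2)
      exact LinearMap.congr_fun this x
    have hc0 : ∀ i, c ⟨i, 0⟩ = 0 := by
      intro i
      have h1 := hzero i ⟨_, hmem⟩
      rw [map_sum, Finset.sum_eq_single i] at h1
      · simpa using h1
      · intro i' _ hi'
        rw [map_smul, Basis.coord_apply, Basis.repr_self, Finsupp.single_apply, if_neg, smul_zero]
        intro h2
        exact hi' (Sigma.mk.inj_iff.1 h2).1
      · simp
    simp only [hc0, zero_smul, Finset.sum_const_zero, map_zero, zero_add] at hc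
    have h3 := Fintype.linearIndependent_iff.1 q.linearIndependent _
      ((map_eq_zero_iff F hF).1 hc)
    rintro ⟨i, j⟩
    exact Fin.cases (hc0 i) (fun j => h3 ⟨i, j⟩) j
  -- The `t` vectors completing `w` to a basis of `Y` become zero rows, that is blocks with `K' =
  -- 0`.
  obtain ⟨t, B, hB⟩ := exists_basis_sum_of_linearIndependent hw
  have : IsEmpty ((_ : Fin t) × Fin 0) := ⟨fun k => k.2.elim0⟩
  let K' : ι ⊕ Fin t → ℕ := Sum.elim (fun i => K i + 1) fun _ => 0
  obtain ⟨q', hq', -⟩ := exists_basis_sigma_sum (fun i => K' i + 1)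
    (B.reindex (Equiv.sumCongr (Equiv.refl _) (e t).symm))
  obtain ⟨p', hp', -⟩ := exists_basis_sigma_sum K'
    (q.reindex (Equiv.sumEmpty _ ((_ : Fin t) × Fin 0)).symm)
  refine ⟨ι ⊕ Fin t, inferInstance, K', p', q', ?_⟩
  rintro (i | i) j
  · have hq1 : ∀ l, q' ⟨Sum.inl i, l⟩ = w ⟨i, l⟩ := by
      intro l
      rw [hq', Basis.reindex_apply]
      exact hB _
    have hp1 : ∀ l, p' ⟨Sum.inl i, l⟩ = q ⟨i, l⟩ := by
      intro l
      exact (hp' i l).trans (Basis.reindex_apply _ _ _)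
    rw [hq1, hq1, hp1]
    refine ⟨?_, rfl⟩
    refine Fin.cases rfl (fun j => ?_) (show Fin (K i + 1) from j)
    have h1 : q ⟨i, j.succ⟩ = (p ⟨i, j⟩ : X) := (h i j).2.symm
    rw [h1, ← hg, (h i j).1]
    rfl
  · exact Fin.elim0 (show Fin 0 from j)



/-! ### Jordan normal form -/

section Jordan

variable {V : Type u} [AddCommGroup V] [Module ℂ V]

/-- The nilpotent endomorphism `N` is a direct sum of nilpotent Jordan blocks. -/
def JordanDecomp (N : V →ₗ[ℂ] V) : Prop :=
  ∃ (ι : Type) (_ : Fintype ι) (K : ι → ℕ) (p : Basis ((i : ι) × Fin (K i + 1)) ℂ V),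
    ∀ i, N (p ⟨i, 0⟩) = 0 ∧ ∀ j : Fin (K i), N (p ⟨i, j.succ⟩) = p ⟨i, j.castSucc⟩

theorem JordanDecomp.kronWith_fin {N : V →ₗ[ℂ] V} (h : JordanDecomp N) (μ : ℂ) :
    KronWith (fun b => ∃ k, b = KBlock.fin μ (k + 1)) LinearMap.id (N + μ • LinearMap.id) := by
  obtain ⟨ι, hι, K, p, h⟩ := h
  refine ⟨ι, hι, fun i => KBlock.fin μ (K i + 1), p, p, fun i => ⟨⟨_, rfl⟩,
    fun (j : Fin (K i + 1)) => ⟨?_, ?_⟩⟩⟩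
  · exact (KBlock.sum_matE_fin μ (K i + 1) (fun r => p ⟨i, r⟩) j).symm
  · refine Fin.cases ?_ (fun j => ?_) j
    · refine Eq.trans ?_ (KBlock.sum_matF_fin_zero μ (K i) (fun r => p ⟨i, r⟩)).symm
      exact (congrArg (· + μ • p ⟨i, 0⟩) (h i).1).trans (zero_add _)
    · refine Eq.trans ?_ (KBlock.sum_matF_fin_succ μ (K i) (fun r => p ⟨i, r⟩) j).symm
      exact (congrArg (· + μ • p ⟨i, j.succ⟩) ((h i).2 j)).trans (add_comm _ _)

theorem JordanDecomp.kronWith_inf {N : V →ₗ[ℂ] V} (h : JordanDecomp N) :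
    KronWith (fun b => ∃ k, b = KBlock.inf (k + 1)) N LinearMap.id := by
  obtain ⟨ι, hι, K, p, h⟩ := h
  let q : Basis ((i : ι) × Fin (K i + 1)) ℂ V :=
    p.reindex (Equiv.sigmaCongrRight fun _ => Fin.revPerm)
  have hq : ∀ i (j : Fin (K i + 1)), q ⟨i, j⟩ = p ⟨i, j.rev⟩ := fun i j => Basis.reindex_apply _ _ _
  have hlast : ∀ i, N (q ⟨i, Fin.last _⟩) = 0 := fun i => by
    rw [hq, Fin.rev_last]; exact (h i).1
  have hcast : ∀ i (j : Fin (K i)), N (q ⟨i, j.castSucc⟩) = q ⟨i, j.succ⟩ := fun i j => by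
    rw [hq, hq, Fin.rev_castSucc, Fin.rev_succ]; exact (h i).2 _
  refine ⟨ι, hι, fun i => KBlock.inf (K i + 1), q, q, fun i => ⟨⟨_, rfl⟩,
    fun (j : Fin (K i + 1)) => ⟨?_, ?_⟩⟩⟩
  · refine Fin.lastCases ?_ (fun j => ?_) j
    · exact (hlast i).trans (KBlock.sum_matE_inf_last (K i) (fun r => q ⟨i, r⟩)).symm
    · exact (hcast i j).trans (KBlock.sum_matE_inf_castSucc (K i) (fun r => q ⟨i, r⟩) j).symm
  · exact (KBlock.sum_matF_inf (K i + 1) (fun r => q ⟨i, r⟩) j).symm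

/-- Induction on the range of `N`: each Jordan chain of the range is prolonged by a preimage of its
top vector, and vectors of the kernel of `N` complete the basis. -/
theorem jordanDecomp_of_isNilpotent (n : ℕ) : ∀ {V : Type u} [AddCommGroup V] [Module ℂ V]
    [FiniteDimensional ℂ V] {N : V →ₗ[ℂ] V}, finrank ℂ V = n → (∃ k, N ^ k = 0) →
    JordanDecomp N := by
  induction n using Nat.strong_induction_on with
  | _ n ih =>
  intro V _ _ _ N hn ⟨k, hk⟩
  rcases Nat.eq_zero_or_pos n with h0 | h0
  · have : Subsingleton V := finrank_zero_iff.1 (hn.trans h0)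
    have : IsEmpty ((_ : Empty) × Fin (0 + 1)) := ⟨fun k => k.1.elim⟩
    exact ⟨Empty, inferInstance, fun _ => 0, (Basis.empty V :
      Basis ((_ : Empty) × Fin (0 + 1)) ℂ V), fun i => i.elim⟩
  let W := LinearMap.range N
  have hNW : ∀ x ∈ W, N x ∈ W := fun x _ => ⟨x, rfl⟩
  have hlt : finrank ℂ W < n := by
    rw [← hn]
    refine Submodule.finrank_lt fun htop => ?_
    have h1 : Function.Surjective (N ^ k) := by
      rw [Module.End.coe_pow]
      exact (LinearMap.range_eq_top.1 htop).iterate k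
    have h2 : Subsingleton V := ⟨fun a b => by
      obtain ⟨a, rfl⟩ := h1 a
      obtain ⟨b, rfl⟩ := h1 b
      rw [hk]
      rfl⟩
    rw [finrank_zero_of_subsingleton] at hn
    omega
  have hpow : ∀ (l : ℕ) (x : W), (((N.restrict hNW) ^ l) x : V) = (N ^ l) x := by
    intro l x
    rw [Module.End.pow_restrict l hNW]
    rfl
  obtain ⟨ι, hι, K, w, hw⟩ := ih _ hlt (N := N.restrict hNW) rfl
    ⟨k, LinearMap.ext fun x => Subtype.ext (by rw [hpow, hk]; rfl)⟩
  choose u hu using fun i => (w ⟨i, Fin.last _⟩).2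
  let v : ((i : ι) × Fin (K i + 1 + 1)) → V := fun k =>
    Fin.lastCases (motive := fun _ => V) (u k.1) (fun j => (w ⟨k.1, j⟩ : V)) k.2
  have hv_cast : ∀ i (j : Fin (K i + 1)), v ⟨i, j.castSucc⟩ = w ⟨i, j⟩ := fun i j =>
    Fin.lastCases_castSucc ..
  have hv_last : ∀ i, v ⟨i, Fin.last _⟩ = u i := fun i => Fin.lastCases_last ..
  have hv_zero : ∀ i, v ⟨i, 0⟩ = w ⟨i, 0⟩ := fun i => hv_cast i 0
  have hN_zero : ∀ i, N (v ⟨i, 0⟩) = 0 := fun i => by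
    rw [hv_zero]
    exact congrArg Subtype.val (hw i).1
  have hN_succ : ∀ i (j : Fin (K i + 1)), N (v ⟨i, j.succ⟩) = w ⟨i, j⟩ := by
    intro i j
    refine Fin.lastCases ?_ (fun j => ?_) j
    · rw [Fin.succ_last, hv_last]
      exact hu i
    · rw [Fin.succ_castSucc, hv_cast]
      exact congrArg Subtype.val ((hw i).2 j)
  have hwl : LinearIndependent ℂ (fun k => (w k : V)) :=
    w.linearIndependent.map' W.subtype W.ker_subtype
  have hN_sum : ∀ c : ((i : ι) × Fin (K i + 1 + 1)) → ℂ, N (∑ k, c k • v k) =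
      ∑ k : (i : ι) × Fin (K i + 1), c ⟨k.1, k.2.succ⟩ • (w k : V) := by
    intro c
    simp [Fintype.sum_sigma, Fin.sum_univ_succ (n := _ + 1), hN_zero, hN_succ]
  -- Applying `N` to a relation kills the bottoms and shifts the chains into the known basis `w`;
  -- only the bottom vectors, which belong to `w`, are left.
  have hvl : LinearIndependent ℂ v := by
    rw [Fintype.linearIndependent_iff]
    intro c hc
    have h1 := Fintype.linearIndependent_iff.1 hwl (fun k => c ⟨k.1, k.2.succ⟩)
      (by rw [← hN_sum, hc, map_zero])
    have h2 : ∑ i, c ⟨i, 0⟩ • (w ⟨i, 0⟩ : V) = 0 := by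
      rw [← hc, Fintype.sum_sigma]
      refine Finset.sum_congr rfl fun i _ => ?_
      rw [Fin.sum_univ_succ, hv_zero, Finset.sum_eq_zero, add_zero]
      intro j _
      rw [h1 ⟨i, j⟩, zero_smul]
    have h3 := Fintype.linearIndependent_iff.1
      (hwl.comp (fun i => (⟨i, 0⟩ : (i : ι) × Fin (K i + 1)))
        fun i i' h => (Sigma.mk.inj_iff.1 h).1) (fun i => c ⟨i, 0⟩) h2
    rintro ⟨i, j⟩
    exact Fin.cases (h3 i) (fun j => h1 ⟨i, j⟩) j
  let bQ := finBasis ℂ (V ⧸ Submodule.span ℂ (Set.range v))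
  -- `N` already maps the span of `v` onto the range, so any lift can be moved into the kernel by
  -- subtracting an element of that span.
  have hlift : ∀ j, ∃ x, N x = 0 ∧ (Submodule.span ℂ (Set.range v)).mkQ x = bQ j := by
    intro j
    obtain ⟨x, hx⟩ := (Submodule.span ℂ (Set.range v)).mkQ_surjective (bQ j)
    let c : ((i : ι) × Fin (K i + 1 + 1)) → ℂ := fun k => Fin.cases (motive := fun _ => ℂ) 0
      (fun l => w.repr ⟨N x, x, rfl⟩ ⟨k.1, l⟩) k.2
    refine ⟨x - ∑ k, c k • v k, ?_, ?_⟩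
    · rw [map_sub, hN_sum, sub_eq_zero]
      have := congrArg Subtype.val (w.sum_repr ⟨N x, x, rfl⟩)
      rw [AddSubmonoidClass.coe_finsetSum] at this
      exact this.symm
    · rw [map_sub, hx, sub_eq_self, Submodule.mkQ_apply, Submodule.Quotient.mk_eq_zero]
      exact Submodule.sum_mem _ fun k _ => Submodule.smul_mem _ _
        (Submodule.subset_span ⟨k, rfl⟩)
  choose z hz0 hz using hlift
  obtain ⟨B, hB, hB'⟩ := exists_basis_sum_of_quotient (Basis.span hvl) bQ z hz
  let t := finrank ℂ (V ⧸ Submodule.span ℂ (Set.range v))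
  let e : ((_ : Fin t) × Fin (0 + 1)) ≃ Fin t :=
    @Equiv.sigmaUnique (Fin t) (fun _ => Fin 1) fun _ => inferInstance
  let K' : ι ⊕ Fin t → ℕ := Sum.elim (fun i => K i + 1) fun _ => 0
  obtain ⟨q, hq, hq'⟩ := exists_basis_sigma_sum (fun i => K' i + 1)
    (B.reindex (Equiv.sumCongr (Equiv.refl _) e.symm))
  have hq1 : ∀ i (l : Fin (K i + 1 + 1)), q ⟨Sum.inl i, l⟩ = v ⟨i, l⟩ := fun i l =>
    ((hq i l).trans (Basis.reindex_apply _ _ _)).trans ((hB _).trans (by rw [Basis.span_apply]; rfl))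
  have hq2 : ∀ i (l : Fin (0 + 1)), q ⟨Sum.inr i, l⟩ = z i := fun i l =>
    ((hq' i l).trans (Basis.reindex_apply _ _ _)).trans (hB' _)
  refine ⟨ι ⊕ Fin t, inferInstance, K', q, ?_⟩
  rintro (i | i)
  · refine ⟨(congrArg N (hq1 i 0)).trans (hN_zero i), fun (j : Fin (K i + 1)) => ?_⟩
    exact (congrArg N (hq1 i j.succ)).trans ((hN_succ i j).trans
      ((hv_cast i j).symm.trans (hq1 i j.castSucc).symm))
  · exact ⟨(congrArg N (hq2 i 0)).trans (hz0 i), fun j => Fin.elim0 (show Fin 0 from j)⟩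

theorem exists_map_range_pow_eq [FiniteDimensional ℂ V] (N : V →ₗ[ℂ] V) :
    ∃ n, (LinearMap.range (N ^ n)).map N = LinearMap.range (N ^ n) := by
  obtain ⟨n, hn⟩ := IsArtinian.monotone_stabilizes N.iterateRange
  exact ⟨n, (LinearMap.iterateRange_succ (f := N) (n := n)).symm.trans (hn (n + 1) n.le_succ).symm⟩

/-- For an eigenvalue `μ` let `R` be the stable range of `N = T - μ`. On the quotient by `R` the map
`N` is nilpotent, on `R` it is onto, so the extension splits, and `R` is proper because `N` is not
injective. Induction applies to `R`. -/
theorem kronWith_fin_id (n : ℕ) : ∀ {V : Type u} [AddCommGroup V] [Module ℂ V]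
    [FiniteDimensional ℂ V] (T : V →ₗ[ℂ] V), finrank ℂ V = n →
    KronWith (fun b => ∃ ν k, b = KBlock.fin ν (k + 1)) LinearMap.id T := by
  induction n using Nat.strong_induction_on with
  | _ n ih =>
  intro V _ _ _ T hn
  rcases subsingleton_or_nontrivial V with hV | hV
  · have h := (jordanDecomp_of_isNilpotent (N := (0 : V →ₗ[ℂ] V)) _ rfl
      ⟨1, pow_one _⟩).kronWith_fin 0
    exact (h.mono fun b ⟨k, hb⟩ => ⟨0, k, hb⟩).congr (LinearEquiv.refl ℂ V) (LinearEquiv.refl ℂ V)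
      (fun _ => rfl) fun x => Subsingleton.elim _ _
  obtain ⟨μ, hμ⟩ := Module.End.exists_eigenvalue T
  let N : V →ₗ[ℂ] V := T - μ • LinearMap.id
  have hTN : T = N + μ • LinearMap.id := (sub_add_cancel _ _).symm
  obtain ⟨k, hk⟩ := exists_map_range_pow_eq N
  let R := LinearMap.range (N ^ k)
  have hNR : R ≤ R.comap N := fun x hx => hk.le (Submodule.mem_map_of_mem hx)
  have hTR : R ≤ R.comap T := fun x hx => by
    rw [hTN]
    exact R.add_mem (hNR hx) (R.smul_mem μ hx)
  have hR : R ≠ ⊤ := by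
    intro hR
    have h1 : LinearMap.range N = ⊤ := by
      rw [eq_top_iff, ← hR]
      exact hk.ge.trans LinearMap.map_le_range
    have h2 : Function.Injective N := LinearMap.injective_iff_surjective.2
      (LinearMap.range_eq_top.1 h1)
    obtain ⟨x, hx⟩ := hμ.exists_hasEigenvector
    refine hx.2 (h2 ?_)
    rw [map_zero]
    exact sub_eq_zero.2 hx.apply_eq_smul
  refine KronWith.of_extension (X₁ := R) (Y₁ := R) (fun x hx => hx) hTR
    (Q := fun b => ∃ k, b = KBlock.fin μ (k + 1)) ?_ ?_ ?_ ?_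
  · exact ih _ (hn ▸ Submodule.finrank_lt hR) (T.restrict hTR) rfl
  · have hnil : JordanDecomp (R.mapQ R N hNR) := by
      refine jordanDecomp_of_isNilpotent _ rfl ⟨k, ?_⟩
      refine Submodule.linearMap_qext _ (LinearMap.ext fun x => ?_)
      have h1 : ∀ l, ((R.mapQ R N hNR) ^ l) (R.mkQ x) = R.mkQ ((N ^ l) x) := by
        intro l
        induction l with
        | zero => rfl
        | succ l ihl => rw [pow_succ', pow_succ', Module.End.mul_apply, ihl]; rfl
      rw [LinearMap.comp_apply, h1]
      exact (Submodule.Quotient.mk_eq_zero _).2 ⟨x, rfl⟩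
    refine (hnil.kronWith_fin μ).congr (LinearEquiv.refl ℂ _) (LinearEquiv.refl ℂ _) ?_ ?_
    · intro x
      obtain ⟨x, rfl⟩ := R.mkQ_surjective x
      rfl
    · intro x
      obtain ⟨x, rfl⟩ := R.mkQ_surjective x
      change R.mkQ (T x) = R.mkQ (N x) + μ • R.mkQ x
      rw [hTN, ← map_smul, ← map_add]
      rfl
  · rintro _ ⟨k, rfl⟩
    exact ⟨μ, k, rfl⟩
  · rintro _ ⟨l, rfl⟩
    refine extVanish_fin μ l ?_
    rintro ⟨y, hy⟩
    obtain ⟨x, hx, rfl⟩ := hk.ge hy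
    exact ⟨⟨x, hx⟩, Subtype.ext rfl⟩

end Jordan



/-! ### Kronecker's theorem -/

section Existence

variable {X Y : Type u} [AddCommGroup X] [Module ℂ X] [AddCommGroup Y] [Module ℂ Y]

/-- The greatest fixed point of $U\mapsto F^{-1}(EU)$. -/
theorem exists_greatest_map_le_map (E F : X →ₗ[ℂ] Y) : ∃ N : Submodule ℂ X,
    N.map F ≤ N.map E ∧ ∀ U : Submodule ℂ X, U.map F ≤ U.map E → U ≤ N := by
  let f : Submodule ℂ X →o Submodule ℂ X := ⟨fun U => (U.map E).comap F,
    fun _ _ h => Submodule.comap_mono (Submodule.map_mono h)⟩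
  refine ⟨f.gfp, Submodule.map_le_iff_le_comap.2 (f.map_gfp).ge, fun U hU => ?_⟩
  exact f.le_gfp (Submodule.map_le_iff_le_comap.1 hU)

/-- The least fixed point of $U\mapsto E^{-1}(FU)$; it will carry the blocks `sK - L`. -/
theorem exists_least_comap_map_eq (E F : X →ₗ[ℂ] Y) : ∃ N : Submodule ℂ X,
    (N.map F).comap E = N ∧ ∀ U : Submodule ℂ X, (U.map F).comap E ≤ U → N ≤ U := by
  let f : Submodule ℂ X →o Submodule ℂ X := ⟨fun U => (U.map F).comap E,
    fun _ _ h => Submodule.comap_mono (Submodule.map_mono h)⟩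
  exact ⟨f.lfp, f.map_lfp, fun U hU => f.lfp_le hU⟩

/-- A subspace of the quotient on which `F` is dominated by `E` lifts, if `E` maps the subspace
`N` onto the second component of the subpair. -/
theorem map_comap_mkQ_le {E F : X →ₗ[ℂ] Y} {N : Submodule ℂ X} (hF : N ≤ (N.map E).comap F)
    {U : Submodule ℂ (X ⧸ N)}
    (hU : U.map (N.mapQ (N.map E) F hF) ≤ U.map (N.mapQ (N.map E) E (Submodule.map_le_iff_le_comap.1 le_rfl))) :
    (U.comap N.mkQ).map F ≤ (U.comap N.mkQ).map E := by
  rintro _ ⟨x, hx, rfl⟩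
  obtain ⟨z, hz, hzx⟩ := hU ⟨N.mkQ x, hx, rfl⟩
  obtain ⟨z, rfl⟩ := N.mkQ_surjective z
  have h1 : F x - E z ∈ N.map E := (Submodule.Quotient.eq _).1 hzx.symm
  obtain ⟨w, hw, hwx⟩ := h1
  refine ⟨z + w, ?_, by rw [map_add, hwx, add_sub_cancel]⟩
  have h2 : N.mkQ w = 0 := (Submodule.Quotient.mk_eq_zero N).2 hw
  change N.mkQ (z + w) ∈ U
  rwa [map_add, h2, add_zero]

theorem eq_bot_of_comap_mkQ_le {N : Submodule ℂ X} {U : Submodule ℂ (X ⧸ N)}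
    (h : U.comap N.mkQ ≤ N) : U = ⊥ := by
  rw [eq_bot_iff]
  intro x hx
  obtain ⟨x, rfl⟩ := N.mkQ_surjective x
  exact (Submodule.Quotient.mk_eq_zero N).2 (h hx)

/-- The preimage under `F` of the range of $F-\mu E$ is closed under $U\mapsto E^{-1}(FU)$: from
$Ex=Fz=(F-\mu E)w$ follows $Fx=(F-\mu E)(x+\mu w)$. -/
theorem surjective_sub_smul {E F : X →ₗ[ℂ] Y} (hF : Function.Surjective F)
    (hU : ∀ U : Submodule ℂ X, (U.map F).comap E ≤ U → U = ⊤) (μ : ℂ) :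
    Function.Surjective (F - μ • E) := by
  have h1 := hU ((LinearMap.range (F - μ • E)).comap F) (by
    rintro x ⟨z, ⟨w, hw⟩, hz⟩
    refine ⟨x + μ • w, ?_⟩
    rw [map_add, map_smul, hw, hz]
    simp)
  intro y
  obtain ⟨x, rfl⟩ := hF y
  have : x ∈ (LinearMap.range (F - μ • E)).comap F := h1 ▸ Submodule.mem_top
  exact this

/-- The dual pair satisfies the hypotheses of `rowDecomp_of_injective` with the roles exchanged: a
subspace `W` with $F^*W\le E^*W$ has a coannihilator of $E^*W$ to which `hU` applies, so $E^*W$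
vanishes on `X` and `W = 0`. -/
theorem kronWith_col [FiniteDimensional ℂ X] [FiniteDimensional ℂ Y] {E F : X →ₗ[ℂ] Y}
    (hE : Function.Surjective E)
    (hU : ∀ U : Submodule ℂ X, (U.map F).comap E ≤ U → U = ⊤) :
    KronWith (fun b => ∃ k, b = KBlock.col (k + 1)) E F := by
  refine RowDecomp.kronWith_of_dual (RowDecomp.swap (rowDecomp_of_injective _ rfl
    (LinearMap.dualMap_injective_of_surjective hE) ?_))
  intro W hW
  have h1 := hU (W.map E.dualMap).dualCoannihilator (by
    rintro x ⟨z, hz, hzx⟩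
    rw [SetLike.mem_coe, Submodule.mem_dualCoannihilator] at hz
    rw [Submodule.mem_dualCoannihilator]
    rintro _ ⟨w, hw, rfl⟩
    obtain ⟨w', hw', hww'⟩ := hW ⟨w, hw, rfl⟩
    have h2 := LinearMap.congr_fun hww' z
    rw [LinearMap.dualMap_apply, LinearMap.dualMap_apply] at h2
    rw [LinearMap.dualMap_apply, ← hzx, ← h2]
    exact hz _ ⟨w', hw', rfl⟩)
  rw [eq_bot_iff]
  intro w hw
  refine LinearMap.ext fun y => ?_
  obtain ⟨x, rfl⟩ := hE y
  have h3 : x ∈ (W.map E.dualMap).dualCoannihilator := h1 ▸ Submodule.mem_top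
  exact (Submodule.mem_dualCoannihilator x).1 h3 _ ⟨w, hw, rfl⟩

theorem kronWith_fin [FiniteDimensional ℂ X] {E F : X →ₗ[ℂ] Y} (hE : Function.Bijective E) :
    KronWith (fun b => ∃ μ k, b = KBlock.fin μ (k + 1)) E F := by
  let e := LinearEquiv.ofBijective E hE
  refine (kronWith_fin_id _ (e.symm.toLinearMap ∘ₗ F) rfl).congr (LinearEquiv.refl ℂ X) e
    (fun _ => rfl) fun x => ?_
  exact (e.apply_symm_apply (F x)).symm

/-- The stable range of $N=EF^{-1}$ pulls back under `F` to a subspace `U` with $FU\le EU$. Hence it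
is zero and `N` is nilpotent. -/
theorem kronWith_inf [FiniteDimensional ℂ Y] {E F : X →ₗ[ℂ] Y} (hF : Function.Bijective F)
    (hU : ∀ U : Submodule ℂ X, U.map F ≤ U.map E → U = ⊥) :
    KronWith (fun b => ∃ k, b = KBlock.inf (k + 1)) E F := by
  let e := LinearEquiv.ofBijective F hF
  have heF : ∀ y, F (e.symm y) = y := e.apply_symm_apply
  let N : Y →ₗ[ℂ] Y := E ∘ₗ e.symm.toLinearMap
  obtain ⟨k, hk⟩ := exists_map_range_pow_eq N
  have h1 := hU ((LinearMap.range (N ^ k)).comap F) (by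
    rintro _ ⟨x, hx, rfl⟩
    obtain ⟨y, hy, hyx⟩ := hk.ge hx
    refine ⟨e.symm y, ?_, hyx⟩
    change F (e.symm y) ∈ LinearMap.range (N ^ k)
    rwa [heF])
  have hnil : N ^ k = 0 := by
    refine LinearMap.ext fun y => ?_
    have h2 : e.symm ((N ^ k) y) ∈ (LinearMap.range (N ^ k)).comap F := by
      rw [Submodule.mem_comap, heF]
      exact ⟨y, rfl⟩
    rw [h1, Submodule.mem_bot, LinearEquiv.map_eq_zero_iff] at h2
    exact h2
  exact (jordanDecomp_of_isNilpotent _ rfl ⟨k, hnil⟩).kronWith_inf.congr e.symm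
    (LinearEquiv.refl ℂ Y) (fun _ => rfl) heF

/-- On the least `N` with $E^{-1}(FN)=N$ both maps are onto $FN$ and only blocks `sK - L` occur. On
the quotient `E` is bijective, which gives Jordan blocks. The extension splits since every $F-\mu E$
is onto on the subpair. -/
theorem kronWith_of_surjective [FiniteDimensional ℂ X] [FiniteDimensional ℂ Y]
    {E F : X →ₗ[ℂ] Y} (hE : Function.Surjective E) : KronWith KBlock.Pos E F := by
  obtain ⟨N, hN, hmin⟩ := exists_least_comap_map_eq E F
  have hEN : N ≤ (N.map F).comap E := hN.ge
  have hFN : N ≤ (N.map F).comap F := Submodule.map_le_iff_le_comap.1 le_rfl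
  have hE' : Function.Surjective (E.restrict (p := N) (q := N.map F) hEN) := by
    rintro ⟨y, hy⟩
    obtain ⟨x, rfl⟩ := hE y
    exact ⟨⟨x, hN.le hy⟩, rfl⟩
  have hF' : Function.Surjective (F.restrict (p := N) (q := N.map F) hFN) := by
    rintro ⟨_, x, hx, rfl⟩
    exact ⟨⟨x, hx⟩, rfl⟩
  have hmin' : ∀ U : Submodule ℂ N, (U.map (F.restrict (p := N) (q := N.map F) hFN)).comap (E.restrict (p := N) (q := N.map F) hEN) ≤ U →
      U = ⊤ := by
    intro U hU
    have h1 := hmin (U.map N.subtype) (by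
      rintro x ⟨_, ⟨z, hz, rfl⟩, hzx⟩
      have hx : x ∈ N := hN.le ⟨z, z.2, hzx⟩
      exact ⟨⟨x, hx⟩, hU ⟨z, hz, Subtype.ext hzx⟩, rfl⟩)
    rw [eq_top_iff]
    rintro x -
    obtain ⟨z, hz, hzx⟩ := h1 x.2
    rwa [← Subtype.ext hzx]
  refine KronWith.of_extension hEN hFN
    ((kronWith_col hE' hmin').mono ?_) (kronWith_fin (F := N.mapQ _ F hFN) ⟨?_, ?_⟩) ?_ ?_
  · rintro _ ⟨k, rfl⟩
    exact k.succ_pos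
  · rw [injective_iff_map_eq_zero]
    intro x hx
    obtain ⟨x, rfl⟩ := N.mkQ_surjective x
    have h1 : E x ∈ N.map F := (Submodule.Quotient.mk_eq_zero _).1 hx
    exact (Submodule.Quotient.mk_eq_zero N).2 (hN.le h1)
  · intro y
    obtain ⟨y, rfl⟩ := (N.map F).mkQ_surjective y
    obtain ⟨x, rfl⟩ := hE y
    exact ⟨N.mkQ x, rfl⟩
  · rintro _ ⟨μ, k, rfl⟩
    exact k.succ_pos
  · rintro _ ⟨μ, k, rfl⟩
    exact extVanish_fin μ k (surjective_sub_smul hF' hmin' μ)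

/-- Here `F` is injective. On the greatest `N` with $EN\le FN$ it is bijective onto $FN$, which
gives the blocks at infinity; the quotient has only blocks `sKᵀ - Lᵀ`. -/
theorem kronWith_inf_or_row [FiniteDimensional ℂ X] [FiniteDimensional ℂ Y] {E F : X →ₗ[ℂ] Y}
    (hU : ∀ U : Submodule ℂ X, U.map F ≤ U.map E → U = ⊥) :
    KronWith (fun b => ∃ k, b = KBlock.inf (k + 1) ∨ b = KBlock.row (k + 1)) E F := by
  have hF : Function.Injective F := by
    rw [← LinearMap.ker_eq_bot]
    refine hU _ ?_
    rintro _ ⟨x, hx, rfl⟩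
    rw [LinearMap.mem_ker.1 hx]
    exact zero_mem _
  obtain ⟨N, hN, hmax⟩ := exists_greatest_map_le_map F E
  have hEN : N ≤ (N.map F).comap E := Submodule.map_le_iff_le_comap.1 hN
  have hFN : N ≤ (N.map F).comap F := Submodule.map_le_iff_le_comap.1 le_rfl
  have hF' : Function.Bijective (F.restrict (p := N) (q := N.map F) hFN) := by
    constructor
    · intro x y hxy
      exact Subtype.ext (hF (congrArg Subtype.val hxy))
    · rintro ⟨_, x, hx, rfl⟩
      exact ⟨⟨x, hx⟩, rfl⟩
  refine KronWith.of_extension hEN hFN ((kronWith_inf hF' ?_).mono ?_)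
    (rowDecomp_of_injective _ rfl ?_ ?_).kronWith ?_ ?_
  · intro U hUN
    have h1 := hU (U.map N.subtype) (by
      rintro _ ⟨_, ⟨x, hx, rfl⟩, rfl⟩
      obtain ⟨z, hz, hzx⟩ := hUN ⟨x, hx, rfl⟩
      exact ⟨z, ⟨z, hz, rfl⟩, congrArg Subtype.val hzx⟩)
    exact Submodule.map_injective_of_injective N.injective_subtype
      (h1.trans (Submodule.map_bot _).symm)
  · rintro _ ⟨k, rfl⟩
    exact ⟨k, Or.inl rfl⟩
  · rw [injective_iff_map_eq_zero]
    intro x hx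
    obtain ⟨x, rfl⟩ := N.mkQ_surjective x
    obtain ⟨z, hz, hzx⟩ := (Submodule.Quotient.mk_eq_zero _).1 hx
    exact (Submodule.Quotient.mk_eq_zero N).2 (hF hzx ▸ hz)
  · intro U hUN
    exact eq_bot_of_comap_mkQ_le (hmax _ (map_comap_mkQ_le hEN hUN))
  · rintro _ ⟨k, rfl⟩
    exact ⟨k, Or.inr rfl⟩
  · rintro _ ⟨k, rfl⟩
    exact extVanish_row_of_surjective_right k hF'.2

/-- Kronecker's theorem: every pair of linear maps is a direct sum of Kronecker blocks. -/
theorem kronWith_pos [FiniteDimensional ℂ X] [FiniteDimensional ℂ Y] (E F : X →ₗ[ℂ] Y) :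
    KronWith KBlock.Pos E F := by
  -- On the greatest `N` with $FN\le EN$ the map `E` is onto $EN$. Maximality leaves no such nonzero
  -- subspace in the quotient, so the two preceding cases cover both pieces.
  obtain ⟨N, hN, hmax⟩ := exists_greatest_map_le_map E F
  have hEN : N ≤ (N.map E).comap E := Submodule.map_le_iff_le_comap.1 le_rfl
  have hFN : N ≤ (N.map E).comap F := Submodule.map_le_iff_le_comap.1 hN
  have hE' : Function.Surjective (E.restrict (p := N) (q := N.map E) hEN) := by
    rintro ⟨_, x, hx, rfl⟩
    exact ⟨⟨x, hx⟩, rfl⟩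
  refine KronWith.of_extension hEN hFN (kronWith_of_surjective hE') (kronWith_inf_or_row ?_) ?_ ?_
  · intro U hUN
    exact eq_bot_of_comap_mkQ_le (hmax _ (map_comap_mkQ_le hFN hUN))
  · rintro _ ⟨k, rfl | rfl⟩
    exacts [k.succ_pos, k.succ_pos]
  · rintro _ ⟨k, rfl | rfl⟩
    exacts [extVanish_inf k hE', extVanish_row_of_surjective_left k hE']

end Existence


/-! ### From block decompositions to canonical forms of matrices -/

section CanonicalForm

/-- The fibres over each value have equal cardinality. This matches the index set of a decomposition
with the positions in a sorted list of blocks. -/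
theorem exists_equiv_of_map_univ_eq {α β γ : Type*} [Fintype α] [Fintype β] {f : α → γ}
    {g : β → γ} (h : Finset.univ.val.map f = Finset.univ.val.map g) :
    ∃ e : α ≃ β, ∀ a, g (e a) = f a := by
  classical
  have hcard : ∀ c, Fintype.card {a // f a = c} = Fintype.card {b // g b = c} := by
    intro c
    have h1 := congrArg (Multiset.count c) h
    rw [Multiset.count_map, Multiset.count_map] at h1
    rw [Fintype.card_subtype, Fintype.card_subtype]
    simpa only [eq_comm (a := c)] using! h1
  exact ⟨Equiv.ofFiberEquiv fun c => Fintype.equivOfCardEq (hcard c),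
    fun a => Equiv.ofFiberEquiv_map _ a⟩

namespace KBlock

/-- The eigenvalue and the size of a Jordan block. -/
def jordan? : KBlock → Option (ℂ × ℕ)
  | fin μ k => some (μ, k)
  | _ => none

/-- The size of a block at infinity. -/
def inf? : KBlock → Option ℕ
  | inf k => some k
  | _ => none

/-- The size of a block `sK - L`. -/
def col? : KBlock → Option ℕ
  | col k => some k
  | _ => none

/-- The size of a block `sKᵀ - Lᵀ`. -/
def row? : KBlock → Option ℕ
  | row k => some k
  | _ => none

end KBlock

/-- The blocks of a list, sorted by their kind. -/
def KroneckerData.ofList (L : List KBlock) (hL : ∀ b ∈ L, b.Pos) : KroneckerData where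
  jordan := L.filterMap KBlock.jordan?
  α := L.filterMap KBlock.inf?
  β := L.filterMap KBlock.col?
  γ := L.filterMap KBlock.row?
  jordan_pos p hp := by
    obtain ⟨b, hb, hbp⟩ := List.mem_filterMap.1 hp
    have := hL b hb
    cases b <;> simp_all [KBlock.jordan?, KBlock.Pos]
    rw [← hbp]
    exact this
  α_pos k hk := by
    obtain ⟨b, hb, hbp⟩ := List.mem_filterMap.1 hk
    have := hL b hb
    cases b <;> simp_all [KBlock.inf?, KBlock.Pos]
  β_pos k hk := by
    obtain ⟨b, hb, hbp⟩ := List.mem_filterMap.1 hk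
    have := hL b hb
    cases b <;> simp_all [KBlock.col?, KBlock.Pos]
  γ_pos k hk := by
    obtain ⟨b, hb, hbp⟩ := List.mem_filterMap.1 hk
    have := hL b hb
    cases b <;> simp_all [KBlock.row?, KBlock.Pos]

theorem KroneckerData.blocks_ofList_perm (L : List KBlock) (hL : ∀ b ∈ L, b.Pos) :
    (KroneckerData.ofList L hL).blocks.Perm L := by
  simp only [KroneckerData.blocks, KroneckerData.ofList]
  clear hL
  induction L with
  | nil => simp
  | cons b L ih =>
    cases b <;> simp only [List.filterMap_cons, KBlock.jordan?, KBlock.inf?, KBlock.col?,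
      KBlock.row?, List.map_cons, List.cons_append, List.append_assoc] at ih ⊢
    · exact ih.cons _
    · exact List.perm_middle.trans (ih.cons _)
    · rw [← List.append_assoc]
      refine List.perm_middle.trans (List.Perm.cons _ ?_)
      rwa [List.append_assoc]
    · rw [← List.append_assoc, ← List.append_assoc]
      refine List.perm_middle.trans (List.Perm.cons _ ?_)
      rwa [List.append_assoc, List.append_assoc]

/-- The transforming matrices are the changes between the standard bases and `p`, `q`. -/
theorem KroneckerData.isFormOf_of_basis (K : KroneckerData) {n m : ℕ}
    (E F : Matrix (Fin n) (Fin m) ℂ) (p : Basis K.ColIdx ℂ (Fin m → ℂ))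
    (q : Basis K.RowIdx ℂ (Fin n → ℂ))
    (h : ∀ i j, E.mulVec (p ⟨i, j⟩) = ∑ r, (K.blocks.get i).matE r j • q ⟨i, r⟩ ∧
      F.mulVec (p ⟨i, j⟩) = ∑ r, (K.blocks.get i).matF r j • q ⟨i, r⟩) : K.IsFormOf E F := by
  classical
  let e : K.RowIdx ≃ Fin n := q.indexEquiv (Pi.basisFun ℂ (Fin n))
  let f : K.ColIdx ≃ Fin m := p.indexEquiv (Pi.basisFun ℂ (Fin m))
  let p' := p.reindex f
  let q' := q.reindex e
  let U : GL (Fin n) ℂ := ⟨q'.toMatrix (Pi.basisFun ℂ (Fin n)), (Pi.basisFun ℂ (Fin n)).toMatrix q',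
    Basis.toMatrix_mul_toMatrix_flip _ _, Basis.toMatrix_mul_toMatrix_flip _ _⟩
  let V : GL (Fin m) ℂ := ⟨(Pi.basisFun ℂ (Fin m)).toMatrix p', p'.toMatrix (Pi.basisFun ℂ (Fin m)),
    Basis.toMatrix_mul_toMatrix_flip _ _, Basis.toMatrix_mul_toMatrix_flip _ _⟩
  have key : ∀ (G : Matrix (Fin n) (Fin m) ℂ)
      (M : ∀ i, Matrix (Fin (K.blocks.get i).rows) (Fin (K.blocks.get i).cols) ℂ)
      (_ : ∀ i j, G.mulVec (p ⟨i, j⟩) = ∑ r, M i r j • q ⟨i, r⟩),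
      U.val * G * V.val = Matrix.reindex e f (Matrix.blockDiagonal' M) := by
    intro G M hG
    have h1 : G = LinearMap.toMatrix (Pi.basisFun ℂ (Fin m)) (Pi.basisFun ℂ (Fin n))
        G.mulVecLin := by
      ext i j
      simp [LinearMap.toMatrix_apply]
    conv_lhs => rw [h1]
    refine (basis_toMatrix_mul_linearMap_toMatrix_mul_basis_toMatrix p' _ q' _ _).trans ?_
    ext r c
    obtain ⟨⟨i', r⟩, rfl⟩ := e.surjective r
    obtain ⟨⟨i, c⟩, rfl⟩ := f.surjective c
    have h2 : p' (f ⟨i, c⟩) = p ⟨i, c⟩ := by rw [Basis.reindex_apply, Equiv.symm_apply_apply]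
    rw [LinearMap.toMatrix_apply, h2, Matrix.mulVecLin_apply, hG, Matrix.reindex_apply,
      Matrix.submatrix_apply, Equiv.symm_apply_apply, Equiv.symm_apply_apply,
      Basis.repr_reindex_apply, Equiv.symm_apply_apply, map_sum, Finsupp.finsetSum_apply]
    simp only [map_smul, Basis.repr_self, Finsupp.smul_single, smul_eq_mul, mul_one]
    by_cases hi : i' = i
    · subst hi
      rw [Matrix.blockDiagonal'_apply_eq, Finset.sum_eq_single r]
      · rw [Finsupp.single_eq_same]
      · intro s _ hs
        rw [Finsupp.single_eq_of_ne]
        simpa using hs.symm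
      · simp
    · rw [Matrix.blockDiagonal'_apply_ne _ _ _ hi, Finset.sum_eq_zero]
      intro s _
      rw [Finsupp.single_eq_of_ne]
      intro h3
      exact hi (Sigma.mk.inj_iff.1 h3).1
  exact ⟨e, f, U, V, key E _ fun i j => (h i j).1, key F _ fun i j => (h i j).2⟩

theorem exists_basis_sigma_congr {α β : Type*} {V : Type*} [AddCommGroup V] [Module ℂ V]
    (σ : α ≃ β) {c : α → ℕ} {d : β → ℕ} (h : ∀ a, d (σ a) = c a)
    (p : Basis ((b : β) × Fin (d b)) ℂ V) :
    ∃ p' : Basis ((a : α) × Fin (c a)) ℂ V, ∀ a j, p' ⟨a, j⟩ = p ⟨σ a, Fin.cast (h a).symm j⟩ :=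
  ⟨p.reindex (Equiv.sigmaCongr σ fun a => finCongr (h a).symm).symm,
    fun _ _ => Basis.reindex_apply _ _ _⟩

theorem KBlock.sum_cast {Y : Type*} [AddCommGroup Y] [Module ℂ Y] {c d : KBlock} (h : d = c)
    (j : Fin c.cols) (v : Fin d.rows → Y) :
    ∑ r, d.matE r (Fin.cast (congrArg KBlock.cols h).symm j) • v r =
      ∑ r, c.matE r j • v (Fin.cast (congrArg KBlock.rows h).symm r) ∧
    ∑ r, d.matF r (Fin.cast (congrArg KBlock.cols h).symm j) • v r =
      ∑ r, c.matF r j • v (Fin.cast (congrArg KBlock.rows h).symm r) := by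
  subst h
  exact ⟨rfl, rfl⟩

/-- Every matrix pencil has a Kronecker canonical form. -/
theorem exists_isFormOf {n m : ℕ} (E F : Matrix (Fin n) (Fin m) ℂ) :
    ∃ K : KroneckerData, K.IsFormOf E F := by
  obtain ⟨ι, hι, b, p, q, h⟩ := kronWith_pos E.mulVecLin F.mulVecLin
  let L := (Finset.univ.val.map b).toList
  have hL : ∀ c ∈ L, c.Pos := by
    intro c hc
    obtain ⟨i, -, rfl⟩ := Multiset.mem_map.1 (Multiset.mem_toList.1 hc)
    exact (h i).1
  let K := KroneckerData.ofList L hL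
  obtain ⟨σ, hσ⟩ := exists_equiv_of_map_univ_eq (f := K.blocks.get) (g := b) (by
    have h1 : Finset.univ.val.map K.blocks.get = K.blocks := by
      rw [Fin.univ_val_map, List.ofFn_get]
    rw [h1, Multiset.coe_eq_coe.2 (KroneckerData.blocks_ofList_perm L hL), Multiset.coe_toList])
  obtain ⟨p', hp'⟩ := exists_basis_sigma_congr σ (fun i => congrArg KBlock.cols (hσ i)) p
  obtain ⟨q', hq'⟩ := exists_basis_sigma_congr σ (fun i => congrArg KBlock.rows (hσ i)) q
  refine ⟨K, K.isFormOf_of_basis E F p' q' fun i j => ?_⟩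
  have h1 := (h (σ i)).2 (Fin.cast (congrArg KBlock.cols (hσ i)).symm j)
  rw [hp']
  simp only [hq']
  have h2 := KBlock.sum_cast (hσ i) j fun r => q ⟨σ i, r⟩
  exact ⟨h1.1.trans h2.1, h1.2.trans h2.2⟩

end CanonicalForm


/-! ### Membership and monotonicity for relations; dimensions of quotients -/

namespace LinRel

section Basic

variable {V : Type*} [AddCommGroup V] [Module ℂ V]

theorem mem_dom {S : LinRel V} {x : V} : x ∈ dom S ↔ ∃ y, (x, y) ∈ S := by
  simp [dom]

theorem mem_ran {S : LinRel V} {y : V} : y ∈ ran S ↔ ∃ x, (x, y) ∈ S := by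
  simp [ran]

theorem mem_ker {S : LinRel V} {x : V} : x ∈ ker S ↔ (x, 0) ∈ S := Iff.rfl

theorem mem_mul {S : LinRel V} {y : V} : y ∈ mul S ↔ (0, y) ∈ S := Iff.rfl

theorem mem_iter_zero {S : LinRel V} {x y : V} : (x, y) ∈ iter S 0 ↔ y = x := Iff.rfl

theorem mem_iter_succ {S : LinRel V} {n : ℕ} {x z : V} :
    (x, z) ∈ iter S (n + 1) ↔ ∃ y, (x, y) ∈ iter S n ∧ (y, z) ∈ S := Iff.rfl

theorem mem_shift {S : LinRel V} {μ : ℂ} {x y : V} :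
    (x, y) ∈ shift S μ ↔ (x, y + μ • x) ∈ S := by
  constructor
  · rintro ⟨⟨a, b⟩, h, hab⟩
    obtain rfl : a = x := congrArg Prod.fst hab
    obtain rfl : b - μ • a = y := congrArg Prod.snd hab
    rwa [sub_add_cancel]
  · intro h
    exact ⟨_, h, by simp⟩

theorem shift_zero (S : LinRel V) : shift S 0 = S := by
  ext ⟨x, y⟩
  rw [mem_shift, zero_smul, add_zero]

theorem ker_iter_mono (S : LinRel V) : Monotone fun k => ker (iter S k) :=
  monotone_nat_of_le_succ fun _ _ hx => ⟨0, hx, S.zero_mem⟩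

theorem mul_iter_mono (S : LinRel V) : Monotone fun k => mul (iter S k) := by
  refine monotone_nat_of_le_succ fun k => ?_
  induction k with
  | zero =>
    intro y hy
    have : y = 0 := hy
    rw [this]
    exact zero_mem _
  | succ k ih =>
    rintro y ⟨z, hz, hzy⟩
    have hz' : z ∈ mul (iter S (k + 1)) := ih hz
    exact ⟨z, hz', hzy⟩

theorem mem_rootMfd {S : LinRel V} {μ : ℂ} {x : V} :
    x ∈ rootMfd S μ ↔ ∃ k, x ∈ ker (iter (shift S μ) k) :=
  Submodule.mem_iSup_of_directed _ (ker_iter_mono _).directed_le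

theorem mem_rootMfdInfty {S : LinRel V} {x : V} :
    x ∈ rootMfdInfty S ↔ ∃ k, x ∈ mul (iter S k) :=
  Submodule.mem_iSup_of_directed _ (mul_iter_mono _).directed_le

/-- This additive form avoids truncated subtraction and does not require `B ≤ A`. -/
theorem quotDim_add_finrank_inf [FiniteDimensional ℂ V] (A B : Submodule ℂ V) :
    quotDim A B + finrank ℂ (A ⊓ B : Submodule ℂ V) = finrank ℂ A := by
  have h : A ⊓ B = (B.submoduleOf A).map A.subtype := (Submodule.map_comap_subtype A B).symm
  rw [h, Submodule.finrank_map_subtype_eq]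
  exact Submodule.finrank_quotient_add_finrank (B.submoduleOf A)

end Basic

end LinRel

/-! ### The Weyr characteristic is additive over products of relations -/

section Product

variable {ι : Type*} {V : Type*} [AddCommGroup V] [Module ℂ V] {U : ι → Type*}
  [∀ i, AddCommGroup (U i)] [∀ i, Module ℂ (U i)] (φ : V ≃ₗ[ℂ] ∀ i, U i)

/-- The subspace `A` corresponds to the product of the subspaces `B i` under `φ`. -/
def IsProd (A : Submodule ℂ V) (B : ∀ i, Submodule ℂ (U i)) : Prop :=
  ∀ x, x ∈ A ↔ ∀ i, φ x i ∈ B i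

/-- The relation `S` corresponds to the product of the relations `T i` under `φ`. -/
def RelProd (S : LinRel V) (T : ∀ i, LinRel (U i)) : Prop :=
  ∀ x y, (x, y) ∈ S ↔ ∀ i, (φ x i, φ y i) ∈ T i

variable {φ}

namespace IsProd

theorem inf {A A' : Submodule ℂ V} {B B' : ∀ i, Submodule ℂ (U i)} (h : IsProd φ A B)
    (h' : IsProd φ A' B') : IsProd φ (A ⊓ A') fun i => B i ⊓ B' i := fun x => by
  simp only [Submodule.mem_inf, h x, h' x, forall_and]

theorem sup {A A' : Submodule ℂ V} {B B' : ∀ i, Submodule ℂ (U i)} (h : IsProd φ A B)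
    (h' : IsProd φ A' B') : IsProd φ (A ⊔ A') fun i => B i ⊔ B' i := fun x => by
  simp only [Submodule.mem_sup]
  constructor
  · rintro ⟨y, hy, z, hz, rfl⟩ i
    exact ⟨_, (h y).1 hy i, _, (h' z).1 hz i, by simp⟩
  · intro hx
    choose y hy z hz hyz using hx
    refine ⟨φ.symm y, (h _).2 (by simpa using hy), φ.symm z, (h' _).2 (by simpa using hz), ?_⟩
    apply φ.injective
    ext i
    simp [hyz]

theorem finrank_eq [Fintype ι] [∀ i, FiniteDimensional ℂ (U i)] {A : Submodule ℂ V}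
    {B : ∀ i, Submodule ℂ (U i)} (h : IsProd φ A B) : finrank ℂ A = ∑ i, finrank ℂ (B i) := by
  let e : A ≃ₗ[ℂ] ∀ i, B i :=
    { toFun := fun x i => ⟨φ x i, (h x).1 x.2 i⟩
      map_add' := fun x y => by ext i; simp
      map_smul' := fun c x => by ext i; simp
      invFun := fun y => ⟨φ.symm fun i => y i, (h _).2 fun i => by simp⟩
      left_inv := fun x => by ext; simp
      right_inv := fun y => by ext i; simp }
  rw [e.finrank_eq, finrank_pi_fintype]

theorem quotDim_eq [Fintype ι] [∀ i, FiniteDimensional ℂ (U i)] {A A' : Submodule ℂ V}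
    {B B' : ∀ i, Submodule ℂ (U i)} (h : IsProd φ A B) (h' : IsProd φ A' B') :
    LinRel.quotDim A A' = ∑ i, LinRel.quotDim (B i) (B' i) := by
  have : FiniteDimensional ℂ V := φ.symm.finiteDimensional
  have h1 := LinRel.quotDim_add_finrank_inf A A'
  have h2 : ∑ i, (LinRel.quotDim (B i) (B' i) + finrank ℂ (B i ⊓ B' i : Submodule ℂ (U i))) =
      ∑ i, finrank ℂ (B i) :=
    Finset.sum_congr rfl fun i _ => LinRel.quotDim_add_finrank_inf (B i) (B' i)
  rw [Finset.sum_add_distrib, ← h.finrank_eq, ← (h.inf h').finrank_eq] at h2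
  omega

/-- With finitely many factors, monotonicity provides one exponent that serves for all of them. -/
theorem iSup [Fintype ι] {A : ℕ → Submodule ℂ V} {B : ℕ → ∀ i, Submodule ℂ (U i)}
    (h : ∀ n, IsProd φ (A n) (B n)) (hA : Monotone A) (hB : ∀ i, Monotone fun n => B n i) :
    IsProd φ (⨆ n, A n) fun i => ⨆ n, B n i := by
  intro x
  rw [Submodule.mem_iSup_of_directed _ hA.directed_le]
  simp only [fun i => Submodule.mem_iSup_of_directed (fun n => B n i) (hB i).directed_le]
  constructor
  · rintro ⟨n, hn⟩ i
    exact ⟨n, (h n x).1 hn i⟩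
  · intro hx
    choose n hn using hx
    exact ⟨Finset.univ.sup n, (h _ x).2 fun i => hB i (Finset.le_sup (Finset.mem_univ i)) (hn i)⟩

end IsProd

namespace RelProd

open LinRel

variable {S S' : LinRel V} {T T' : ∀ i, LinRel (U i)}

theorem ker (h : RelProd φ S T) : IsProd φ S.ker fun i => (T i).ker := fun x => by
  simpa [mem_ker] using h x 0

theorem mul (h : RelProd φ S T) : IsProd φ S.mul fun i => (T i).mul := fun x => by
  simpa [mem_mul] using h 0 x

theorem dom (h : RelProd φ S T) : IsProd φ S.dom fun i => (T i).dom := fun x => by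
  simp only [mem_dom, h x]
  refine ⟨fun ⟨y, hy⟩ i => ⟨_, hy i⟩, fun hx => ?_⟩
  choose y hy using hx
  exact ⟨φ.symm y, by simpa using hy⟩

theorem ran (h : RelProd φ S T) : IsProd φ S.ran fun i => (T i).ran := fun x => by
  simp only [mem_ran, h _ x]
  refine ⟨fun ⟨y, hy⟩ i => ⟨_, hy i⟩, fun hx => ?_⟩
  choose y hy using hx
  exact ⟨φ.symm y, by simpa using hy⟩

theorem iter (h : RelProd φ S T) (n : ℕ) : RelProd φ (S.iter n) fun i => (T i).iter n := by
  induction n with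
  | zero =>
    intro x y
    simp only [mem_iter_zero]
    rw [← φ.injective.eq_iff, funext_iff]
  | succ n ih =>
    intro x z
    simp only [mem_iter_succ, ih x, h _ z]
    refine ⟨fun ⟨y, hy, hyz⟩ i => ⟨_, hy i, hyz i⟩, fun hx => ?_⟩
    choose y hy hyz using hx
    exact ⟨φ.symm y, by simpa using hy, by simpa using hyz⟩

theorem shift (h : RelProd φ S T) (μ : ℂ) : RelProd φ (S.shift μ) fun i => (T i).shift μ := by
  intro x y
  simp only [mem_shift, h x, map_add, map_smul, Pi.add_apply, Pi.smul_apply]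

variable [Fintype ι]

theorem rootMfd (h : RelProd φ S T) (μ : ℂ) : IsProd φ (S.rootMfd μ) fun i => (T i).rootMfd μ :=
  IsProd.iSup (fun n => ((h.shift μ).iter n).ker) (ker_iter_mono _) fun _ => ker_iter_mono _

theorem rootMfdInfty (h : RelProd φ S T) :
    IsProd φ S.rootMfdInfty fun i => (T i).rootMfdInfty :=
  IsProd.iSup (fun n => (h.iter n).mul) (mul_iter_mono _) fun _ => mul_iter_mono _

theorem singChains (h : RelProd φ S T) : IsProd φ S.singChains fun i => (T i).singChains :=
  (h.rootMfd 0).inf h.rootMfdInfty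

variable [∀ i, FiniteDimensional ℂ (U i)]

theorem weyrW (h : RelProd φ S T) (μ : ℂ) (k : ℕ) : S.weyrW μ k = ∑ i, (T i).weyrW μ k :=
  (((h.shift μ).iter (k + 1)).ker.sup h.singChains).quotDim_eq
    (((h.shift μ).iter k).ker.sup h.singChains)

theorem weyrA (h : RelProd φ S T) (k : ℕ) : S.weyrA k = ∑ i, (T i).weyrA k :=
  ((h.iter (k + 1)).mul.sup h.singChains).quotDim_eq ((h.iter k).mul.sup h.singChains)

theorem weyrB (h : RelProd φ S T) (k : ℕ) : S.weyrB k = ∑ i, (T i).weyrB k :=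
  ((h.iter (k + 1)).ker.inf h.singChains).quotDim_eq ((h.iter k).ker.inf h.singChains)

theorem weyrC (h : RelProd φ S T) (k : ℕ) : S.weyrC k = ∑ i, (T i).weyrC k := by
  cases k with
  | zero => exact (h.ran.sup h.dom).quotDim_eq (h.ran.sup (h.rootMfd 0))
  | succ k =>
    exact ((h.iter (k + 2)).ran.sup (h.rootMfd 0)).quotDim_eq
      ((h.iter (k + 3)).ran.sup (h.rootMfd 0))

end RelProd

end Product

/-- The kernel representation of a diagonal block. -/
def KBlock.rel (b : KBlock) : LinRel (Fin b.cols → ℂ) := kernelRep b.matE b.matF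

theorem mem_kernelRep {n m : ℕ} {E F : Matrix (Fin n) (Fin m) ℂ} {x y : Fin m → ℂ} :
    (x, y) ∈ kernelRep E F ↔ F.mulVec x = E.mulVec y := Iff.rfl

theorem blockDiagonal'_mulVec {ι : Type*} [Fintype ι] [DecidableEq ι] {r c : ι → ℕ}
    (M : ∀ i, Matrix (Fin (r i)) (Fin (c i)) ℂ) (x : ((i : ι) × Fin (c i)) → ℂ) (i : ι)
    (j : Fin (r i)) :
    (Matrix.blockDiagonal' M).mulVec x ⟨i, j⟩ = (M i).mulVec (fun l => x ⟨i, l⟩) j := by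
  simp only [Matrix.mulVec, dotProduct, Fintype.sum_sigma]
  rw [Finset.sum_eq_single i]
  · simp
  · intro i' _ hi
    exact Finset.sum_eq_zero fun l _ => by
      rw [Matrix.blockDiagonal'_apply_ne _ _ _ (Ne.symm hi), zero_mul]
  · simp

/-- A pencil acts like the direct sum of the blocks of its Kronecker canonical form. -/
theorem KroneckerData.IsFormOf.exists_linearEquiv {K : KroneckerData} {n m : ℕ}
    {E F : Matrix (Fin n) (Fin m) ℂ} (h : K.IsFormOf E F) :
    ∃ (φ : (Fin m → ℂ) ≃ₗ[ℂ] ∀ i, (Fin (K.blocks.get i).cols → ℂ))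
      (ψ : (Fin n → ℂ) ≃ₗ[ℂ] ∀ i, (Fin (K.blocks.get i).rows → ℂ)), ∀ x i,
      ψ (E.mulVec x) i = (K.blocks.get i).matE.mulVec (φ x i) ∧
      ψ (F.mulVec x) i = (K.blocks.get i).matF.mulVec (φ x i) := by
  obtain ⟨e, f, U, V, hE, hF⟩ := h
  let v : (Fin m → ℂ) ≃ₗ[ℂ] (Fin m → ℂ) :=
    Matrix.toLin'OfInv (M := V.val) (M' := V⁻¹.val) V.mul_inv V.inv_mul
  let u : (Fin n → ℂ) ≃ₗ[ℂ] (Fin n → ℂ) :=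
    Matrix.toLin'OfInv (M := U⁻¹.val) (M' := U.val) U.inv_mul U.mul_inv
  let φ := (v.trans (LinearEquiv.funCongrLeft ℂ ℂ f)).trans
    (LinearEquiv.piCurry ℂ fun (i : Fin K.blocks.length) (_ : Fin (K.blocks.get i).cols) => ℂ)
  let ψ := (u.trans (LinearEquiv.funCongrLeft ℂ ℂ e)).trans
    (LinearEquiv.piCurry ℂ fun (i : Fin K.blocks.length) (_ : Fin (K.blocks.get i).rows) => ℂ)
  have key : ∀ (G : Matrix (Fin n) (Fin m) ℂ)
      (M : ∀ i, Matrix (Fin (K.blocks.get i).rows) (Fin (K.blocks.get i).cols) ℂ)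
      (_ : U.val * G * V.val = Matrix.reindex e f (Matrix.blockDiagonal' M)) (x : Fin m → ℂ) i,
      ψ (G.mulVec x) i = (M i).mulVec (φ x i) := by
    intro G M hG x i
    ext r
    have h1 : U.val * G = Matrix.reindex e f (Matrix.blockDiagonal' M) * V⁻¹.val := by
      rw [← hG, Matrix.mul_assoc _ V.val, V.mul_inv, Matrix.mul_one]
    change U.val.mulVec (G.mulVec x) (e ⟨i, r⟩) = _
    rw [Matrix.mulVec_mulVec, h1, ← Matrix.mulVec_mulVec, Matrix.reindex_apply,
      Matrix.submatrix_mulVec_equiv, Function.comp_apply, Equiv.symm_apply_apply,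
      blockDiagonal'_mulVec]
    rfl
  exact ⟨φ, ψ, fun x i => ⟨key E _ hE x i, key F _ hF x i⟩⟩

/-- The kernel representation of a pencil is the product of the kernel representations of the
blocks of its Kronecker canonical form. -/
theorem KroneckerData.IsFormOf.exists_relProd {K : KroneckerData} {n m : ℕ}
    {E F : Matrix (Fin n) (Fin m) ℂ} (h : K.IsFormOf E F) :
    ∃ φ : (Fin m → ℂ) ≃ₗ[ℂ] ∀ i, (Fin (K.blocks.get i).cols → ℂ),
      RelProd φ (kernelRep E F) fun i => (K.blocks.get i).rel := by
  obtain ⟨φ, ψ, hφ⟩ := h.exists_linearEquiv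
  refine ⟨φ, fun x y => ?_⟩
  rw [mem_kernelRep, ← ψ.injective.eq_iff, funext_iff]
  refine forall_congr' fun i => ?_
  rw [(hφ x i).2, (hφ y i).1]
  rfl


/-! ### Sequences extended by zero and coordinate subspaces -/

section ZeroExtension

variable {k : ℕ}

/-- The extension of a finite sequence by zeros. -/
def zext (x : Fin k → ℂ) (n : ℕ) : ℂ := if h : n < k then x ⟨n, h⟩ else 0

theorem zext_val (x : Fin k → ℂ) (i : Fin k) : zext x i = x i := dif_pos i.2

theorem zext_of_le (x : Fin k → ℂ) {n : ℕ} (h : k ≤ n) : zext x n = 0 := dif_neg (not_lt.2 h)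

theorem zext_of_lt (f : ℕ → ℂ) {n : ℕ} (h : n < k) : zext (fun i : Fin k => f i) n = f n :=
  dif_pos h

@[simp]
theorem zext_zero (n : ℕ) : zext (0 : Fin k → ℂ) n = 0 := by simp [zext]

theorem zext_add (x y : Fin k → ℂ) (n : ℕ) : zext (x + y) n = zext x n + zext y n := by
  by_cases h : n < k <;> simp [zext, h]

theorem zext_smul (c : ℂ) (x : Fin k → ℂ) (n : ℕ) : zext (c • x) n = c * zext x n := by
  by_cases h : n < k <;> simp [zext, h]

theorem eq_of_zext_eq {x y : Fin k → ℂ} (h : ∀ n < k, zext x n = zext y n) : x = y := by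
  ext i
  rw [← zext_val x, ← zext_val y]
  exact h i i.2

/-- The subspace `A` consists of the vectors whose coordinates with property `p` vanish. -/
def IsCoord (A : Submodule ℂ (Fin k → ℂ)) (p : ℕ → Prop) : Prop :=
  ∀ x, x ∈ A ↔ ∀ j < k, p j → zext x j = 0

namespace IsCoord

variable {A B : Submodule ℂ (Fin k → ℂ)} {p q : ℕ → Prop}

theorem sup (hA : IsCoord A p) (hB : IsCoord B q) : IsCoord (A ⊔ B) fun j => p j ∧ q j := by
  classical
  intro x
  rw [Submodule.mem_sup]
  constructor
  · rintro ⟨y, hy, z, hz, rfl⟩ j hj ⟨hp, hq⟩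
    rw [zext_add, (hA y).1 hy j hj hp, (hB z).1 hz j hj hq, add_zero]
  · intro hx
    refine ⟨fun j : Fin k => if p j then 0 else zext x j, (hA _).2 fun j hj hp => ?_,
      fun j : Fin k => if p j then zext x j else 0, (hB _).2 fun j hj hq => ?_, ?_⟩
    · exact (zext_of_lt (fun j => if p j then 0 else zext x j) hj).trans (if_pos hp)
    · refine (zext_of_lt (fun j => if p j then zext x j else 0) hj).trans ?_
      by_cases hp : p j
      · rw [if_pos hp]
        exact hx j hj ⟨hp, hq⟩
      · exact if_neg hp
    · ext j
      by_cases hp : p j <;> simp [hp, zext_val]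

theorem eq_top (hA : IsCoord A p) (hp : ∀ j < k, ¬ p j) : A = ⊤ :=
  eq_top_iff.2 fun x _ => (hA x).2 fun j hj h => absurd h (hp j hj)

theorem isProd [DecidablePred p] (hA : IsCoord A p) : IsProd (LinearEquiv.refl ℂ (Fin k → ℂ)) A
    fun j => if p j then ⊥ else ⊤ := by
  intro x
  rw [hA x, ← Fin.forall_iff (p := fun j : Fin k => p j → zext x j = 0)]
  refine forall_congr' fun j => ?_
  by_cases hp : p j <;> simp [hp, zext_val]

/-- A coordinate contributes one exactly if it is free in `A` and zero in `B`; in all applications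
at most the single coordinate `t` does. -/
theorem quotDim_eq (hA : IsCoord A p) (hB : IsCoord B q) (t : ℕ) (P : Prop) [Decidable P]
    (h : ∀ j < k, (¬ p j ∧ q j) ↔ (j = t ∧ P)) (hP : P → t < k) :
    LinRel.quotDim A B = if P then 1 else 0 := by
  classical
  have h1 : ∀ j : Fin k, LinRel.quotDim (if p j then (⊥ : Submodule ℂ ℂ) else ⊤)
      (if q j then ⊥ else ⊤) = if j.val = t ∧ P then 1 else 0 := by
    intro j
    rw [← if_congr (h j j.2) rfl rfl]
    by_cases hp : p j
    · simp [hp, LinRel.quotDim_eq_zero]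
    by_cases hq : q j
    · have h2 := LinRel.quotDim_add_finrank_inf (⊤ : Submodule ℂ ℂ) ⊥
      rw [inf_bot_eq, finrank_bot, finrank_top, finrank_self] at h2
      simpa [hp, hq] using h2
    · simp [hp, hq, LinRel.quotDim_eq_zero]
  rw [hA.isProd.quotDim_eq hB.isProd, Finset.sum_congr rfl fun j _ => h1 j]
  by_cases hP' : P
  · rw [Finset.sum_eq_single (⟨t, hP hP'⟩ : Fin k)]
    · simp [hP']
    · intro j _ hj
      rw [if_neg]
      rintro ⟨h2, -⟩
      exact hj (Fin.ext h2)
    · simp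
  · simp [hP']

end IsCoord

end ZeroExtension

/-! ### The Weyr characteristics of the four kinds of block relations -/

namespace LinRel

section Vanishing

variable {V : Type*} [AddCommGroup V] [Module ℂ V] {S : LinRel V}

theorem rootMfdInfty_eq_bot (h : mul S = ⊥) : rootMfdInfty S = ⊥ := by
  rw [rootMfdInfty, iSup_eq_bot]
  exact fun k => mul_iter_eq_bot h k

theorem rootMfd_zero_eq_bot (h : ker S = ⊥) : rootMfd S 0 = ⊥ := by
  rw [rootMfd, iSup_eq_bot, shift_zero]
  exact fun k => ker_iter_eq_bot h k

theorem singChains_eq_bot_of_mul (h : mul S = ⊥) : singChains S = ⊥ := by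
  rw [singChains, rootMfdInfty_eq_bot h, inf_bot_eq]

theorem singChains_eq_bot_of_ker (h : ker S = ⊥) : singChains S = ⊥ := by
  rw [singChains, rootMfd_zero_eq_bot h, bot_inf_eq]

theorem weyrB_eq_zero (h : singChains S = ⊥) (k : ℕ) : weyrB S k = 0 := by
  refine quotDim_eq_zero ?_
  rw [h, inf_bot_eq]
  exact bot_le

theorem weyrW_eq_zero_of_top (h : singChains S = ⊤) (μ : ℂ) (k : ℕ) : weyrW S μ k = 0 := by
  refine quotDim_eq_zero ?_
  rw [h, sup_top_eq, sup_top_eq]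

theorem weyrA_eq_zero_of_top (h : singChains S = ⊤) (k : ℕ) : weyrA S k = 0 := by
  refine quotDim_eq_zero ?_
  rw [h, sup_top_eq, sup_top_eq]

theorem weyrW_eq_zero_of_ker {μ : ℂ} (h : ker (shift S μ) = ⊥) (k : ℕ) : weyrW S μ k = 0 :=
  weyrW_of_not_proper (fun h' => h'.1 h) k

theorem weyrA_eq_zero_of_mul (h : mul S = ⊥) (k : ℕ) : weyrA S k = 0 :=
  weyrA_of_not_proper (fun h' => h'.1 h) k

theorem weyrC_eq_zero_of_rootMfd (h : rootMfd S 0 = ⊤) (k : ℕ) : weyrC S k = 0 := by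
  cases k
  · exact quotDim_eq_zero (by rw [h, sup_top_eq]; exact le_top)
  · exact quotDim_eq_zero (by rw [h, sup_top_eq, sup_top_eq])

theorem ran_iter_eq_top (h : ran S = ⊤) (n : ℕ) : ran (iter S n) = ⊤ := by
  rw [eq_top_iff]
  rintro z -
  rw [mem_ran]
  revert z
  induction n with
  | zero => exact fun z => ⟨z, rfl⟩
  | succ n ih =>
    intro z
    have hz : z ∈ ran S := h ▸ Submodule.mem_top
    obtain ⟨y, hy⟩ := mem_ran.1 hz
    obtain ⟨x, hx⟩ := @ih y
    exact ⟨x, y, hx, hy⟩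

theorem weyrC_eq_zero_of_ran (h : ran S = ⊤) (k : ℕ) : weyrC S k = 0 := by
  cases k
  · exact quotDim_eq_zero (by rw [h, top_sup_eq, top_sup_eq])
  · exact quotDim_eq_zero (by rw [ran_iter_eq_top h, ran_iter_eq_top h])

end Vanishing

section Blocks

variable {k : ℕ} {T : LinRel (Fin k → ℂ)}

theorem eq_bot_of_zext {A : Submodule ℂ (Fin k → ℂ)} (h : ∀ x ∈ A, ∀ n < k, zext x n = 0) :
    A = ⊥ :=
  eq_bot_iff.2 fun x hx => eq_of_zext_eq fun n hn => (h x hx n hn).trans (zext_zero n).symm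

theorem zext_eq_zero_of_recurrence {x : Fin k → ℂ}
    (h : ∀ n < k, zext x (n + 1) = 0 → zext x n = 0) (n : ℕ) : zext x n = 0 := by
  suffices H : ∀ t n, k ≤ n + t → zext x n = 0 from H k n (by omega)
  intro t
  induction t with
  | zero => exact fun n hn => zext_of_le x hn
  | succ t ih =>
    intro n hn
    by_cases hk : n < k
    · exact h n hk (ih _ (by omega))
    · exact zext_of_le x (by omega)

/-! #### The relation of a Jordan block -/

/-- `T` is the graph of a Jordan block. -/
def IsJordanGraph (T : LinRel (Fin k → ℂ)) (ν : ℂ) : Prop :=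
  ∀ x y, (x, y) ∈ T ↔ ∀ n < k, zext y n = ν * zext x n + zext x (n + 1)

namespace IsJordanGraph

variable {ν : ℂ}

theorem shift (h : IsJordanGraph T ν) (μ : ℂ) : IsJordanGraph (T.shift μ) (ν - μ) := by
  intro x y
  rw [mem_shift, h]
  refine forall₂_congr fun n _ => ?_
  rw [zext_add, zext_smul, ← eq_sub_iff_add_eq, sub_mul, add_sub_right_comm]

theorem mul_eq_bot (h : IsJordanGraph T ν) : mul T = ⊥ :=
  eq_bot_of_zext fun y hy n hn => by simpa using (h 0 y).1 hy n hn

theorem ker_eq_bot (h : IsJordanGraph T ν) (hν : ν ≠ 0) : ker T = ⊥ := by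
  refine eq_bot_of_zext fun x hx n _ => zext_eq_zero_of_recurrence (fun n hn h0 => ?_) n
  have h1 := (h x 0).1 hx n hn
  rw [zext_zero, h0, add_zero, eq_comm, mul_eq_zero] at h1
  exact h1.resolve_left hν

theorem mem_iter (h : IsJordanGraph T 0) (n : ℕ) (x y : Fin k → ℂ) :
    (x, y) ∈ iter T n ↔ ∀ i < k, zext y i = zext x (i + n) := by
  induction n generalizing y with
  | zero =>
    rw [mem_iter_zero]
    exact ⟨fun h i _ => by rw [h, add_zero], fun h => eq_of_zext_eq h⟩
  | succ n ih =>
    rw [mem_iter_succ]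
    have h1 : ∀ y : Fin k → ℂ, (∀ i < k, zext y i = zext x (i + n)) → ∀ i,
        zext y i = zext x (i + n) := by
      intro y hy i
      by_cases hi : i < k
      · exact hy i hi
      · rw [zext_of_le _ (not_lt.1 hi), zext_of_le]
        omega
    constructor
    · rintro ⟨z, hz, hzy⟩ i hi
      rw [(h z y).1 hzy i hi, zero_mul, zero_add, h1 z ((ih z).1 hz), Nat.add_right_comm i 1 n, add_assoc]
    · intro hy
      have h2 : ∀ i < k, zext (fun i : Fin k => zext x (i + n)) i = zext x (i + n) :=
        fun i hi => zext_of_lt (fun i => zext x (i + n)) hi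
      refine ⟨fun i => zext x (i + n), (ih _).2 h2, (h _ _).2 fun i hi => ?_⟩
      rw [hy i hi, zero_mul, zero_add, h1 _ h2, Nat.add_right_comm i 1 n, add_assoc]

theorem isCoord_ker_iter (h : IsJordanGraph T 0) (n : ℕ) :
    IsCoord (ker (iter T n)) fun j => n ≤ j := by
  intro x
  rw [mem_ker, h.mem_iter]
  constructor
  · intro hx j hj hnj
    have h1 := hx (j - n) (by omega)
    rw [zext_zero, Nat.sub_add_cancel hnj] at h1
    exact h1.symm
  · intro hx i hi
    rw [zext_zero]
    by_cases hin : i + n < k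
    · exact (hx _ hin (by omega)).symm
    · exact (zext_of_le x (by omega)).symm

theorem ran_eq_top (h : IsJordanGraph T ν) (hν : ν ≠ 0) : ran T = ⊤ := by
  let J : (Fin k → ℂ) →ₗ[ℂ] (Fin k → ℂ) :=
    { toFun := fun x i => ν * zext x i + zext x (i + 1)
      map_add' := fun x y => by ext i; simp only [zext_add, Pi.add_apply]; ring
      map_smul' := fun c x => by
        ext i; simp only [zext_smul, Pi.smul_apply, smul_eq_mul, RingHom.id_apply]; ring }
  have hJ : ∀ x, (x, J x) ∈ T := fun x => (h _ _).2 fun n hn =>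
    zext_of_lt (fun n => ν * zext x n + zext x (n + 1)) hn
  have hinj : Function.Injective J := by
    rw [injective_iff_map_eq_zero]
    intro x hx
    have h1 : x ∈ ker T := mem_ker.2 (hx ▸ hJ x)
    rwa [h.ker_eq_bot hν] at h1
  rw [eq_top_iff]
  rintro y -
  obtain ⟨x, rfl⟩ := LinearMap.injective_iff_surjective.1 hinj y
  exact mem_ran.2 ⟨x, hJ x⟩

/-- A graph has no multivalued part, hence no singular chains, so only the kernels of powers of the
shifted block matter. -/
theorem weyrW_eq (h : IsJordanGraph T ν) (μ : ℂ) (n : ℕ) :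
    weyrW T μ n = if ν = μ ∧ n < k then 1 else 0 := by
  by_cases hν : ν = μ
  · subst hν
    have h0 : IsJordanGraph (T.shift ν) 0 := by
      have := h.shift ν
      rwa [sub_self] at this
    rw [weyrW, singChains_eq_bot_of_mul h.mul_eq_bot, sup_bot_eq, sup_bot_eq]
    refine (h0.isCoord_ker_iter (n + 1)).quotDim_eq (h0.isCoord_ker_iter n) n _ ?_ fun h => h.2
    intro j hj
    simp only [true_and]
    omega
  · rw [if_neg fun h => hν h.1]
    exact weyrW_eq_zero_of_ker ((h.shift μ).ker_eq_bot (sub_ne_zero.2 hν)) n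

theorem weyrC_eq_zero (h : IsJordanGraph T ν) (n : ℕ) : weyrC T n = 0 := by
  by_cases hν : ν = 0
  · subst hν
    refine weyrC_eq_zero_of_rootMfd (eq_top_iff.2 fun x _ => mem_rootMfd.2 ⟨k, ?_⟩) n
    rw [shift_zero, (h.isCoord_ker_iter k).eq_top fun j hj => not_le.2 hj]
    exact Submodule.mem_top
  · exact weyrC_eq_zero_of_ran (h.ran_eq_top hν) n

end IsJordanGraph

/-! #### The relation of a block at infinity -/

/-- `T` is the inverse of the graph of a nilpotent Jordan block. -/
def IsInvShift (T : LinRel (Fin k → ℂ)) : Prop :=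
  ∀ x y, (x, y) ∈ T ↔ ∀ i < k, zext x i = if 1 ≤ i then zext y (i - 1) else 0

namespace IsInvShift

theorem mem_iter (h : IsInvShift T) (n : ℕ) (x y : Fin k → ℂ) :
    (x, y) ∈ iter T n ↔ ∀ i < k, zext x i = if n ≤ i then zext y (i - n) else 0 := by
  induction n generalizing y with
  | zero =>
    rw [mem_iter_zero]
    exact ⟨fun h i _ => by simp [h], fun h => eq_of_zext_eq fun i hi => by simp [h i hi]⟩
  | succ n ih =>
    rw [mem_iter_succ]
    have key : ∀ z : Fin k → ℂ, (∀ i < k, zext z i = if 1 ≤ i then zext y (i - 1) else 0) →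
        ∀ i < k, (if n ≤ i then zext z (i - n) else 0) =
          if n + 1 ≤ i then zext y (i - (n + 1)) else 0 := by
      intro z hz i hi
      by_cases h1 : n ≤ i
      · rw [if_pos h1, hz _ (by omega)]
        by_cases h2 : n + 1 ≤ i
        · rw [if_pos h2, if_pos (by omega), Nat.sub_sub]
        · rw [if_neg h2, if_neg (by omega)]
      · rw [if_neg h1, if_neg (by omega)]
    constructor
    · rintro ⟨z, hz, hzy⟩ i hi
      rw [(ih z).1 hz i hi, key z ((h z y).1 hzy) i hi]
    · intro hx
      have h2 : ∀ i < k, zext (fun i : Fin k => if 1 ≤ i.val then zext y (i - 1) else 0) i =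
          if 1 ≤ i then zext y (i - 1) else 0 :=
        fun i hi => zext_of_lt (fun i => if 1 ≤ i then zext y (i - 1) else 0) hi
      exact ⟨_, (ih _).2 fun i hi => (hx i hi).trans (key _ h2 i hi).symm, (h _ _).2 h2⟩

theorem isCoord_mul_iter (h : IsInvShift T) (n : ℕ) :
    IsCoord (mul (iter T n)) fun j => j + n < k := by
  intro y
  rw [mem_mul, h.mem_iter]
  constructor
  · intro hy j hj hjn
    have h1 := hy (j + n) hjn
    rw [zext_zero, if_pos (by omega), Nat.add_sub_cancel] at h1
    exact h1.symm
  · intro hy i hi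
    rw [zext_zero]
    by_cases hin : n ≤ i
    · rw [if_pos hin, hy _ (by omega) (by omega)]
    · rw [if_neg hin]

theorem ker_shift_eq_bot (h : IsInvShift T) (μ : ℂ) : ker (T.shift μ) = ⊥ := by
  refine eq_bot_of_zext fun x hx n => ?_
  rw [mem_ker, mem_shift, zero_add, h] at hx
  induction n with
  | zero => exact fun hn => by simpa using hx 0 hn
  | succ n ih =>
    intro hn
    rw [hx _ hn, if_pos (by omega), zext_smul, Nat.add_sub_cancel, ih (by omega), mul_zero]

theorem ker_eq_bot (h : IsInvShift T) : ker T = ⊥ := by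
  have := h.ker_shift_eq_bot 0
  rwa [shift_zero] at this

theorem ran_eq_top (h : IsInvShift T) : ran T = ⊤ :=
  eq_top_iff.2 fun y _ => mem_ran.2 ⟨fun i => if 1 ≤ i.val then zext y (i - 1) else 0,
    (h _ _).2 fun _ hi => zext_of_lt (fun i => if 1 ≤ i then zext y (i - 1) else 0) hi⟩

theorem weyrA_eq (h : IsInvShift T) (n : ℕ) : weyrA T n = if n < k then 1 else 0 := by
  rw [weyrA, singChains_eq_bot_of_ker h.ker_eq_bot, sup_bot_eq, sup_bot_eq]
  -- The subspace $\operatorname{mul}T^n$ is carried by the last `n` coordinates, so passing to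
  -- $n+1$ frees coordinate $k-1-n$.
  refine (h.isCoord_mul_iter (n + 1)).quotDim_eq (h.isCoord_mul_iter n) (k - 1 - n) _ ?_ ?_
  · intro j hj
    omega
  · omega

end IsInvShift

/-! #### The relation of a block `sK - L` -/

/-- `T` consists of the pairs `(x, y)` such that `y` is the truncated shift of `x`, with its last
entry free. -/
def IsSingularShift (T : LinRel (Fin k → ℂ)) : Prop :=
  ∀ x y, (x, y) ∈ T ↔ ∀ i, i + 1 < k → zext x (i + 1) = zext y i

namespace IsSingularShift

theorem mem_iter (h : IsSingularShift T) (n : ℕ) (x y : Fin k → ℂ) :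
    (x, y) ∈ iter T n ↔ ∀ i, i + n < k → zext x (i + n) = zext y i := by
  induction n generalizing y with
  | zero =>
    rw [mem_iter_zero]
    exact ⟨fun h i _ => by rw [h, add_zero], fun h => eq_of_zext_eq fun i hi => (h i hi).symm⟩
  | succ n ih =>
    rw [mem_iter_succ]
    constructor
    · rintro ⟨z, hz, hzy⟩ i hi
      rw [← (h z y).1 hzy i (by omega), ← (ih z).1 hz (i + 1) (by omega), add_right_comm,
        add_assoc]
    · intro hx
      -- The intermediate vector is prescribed by `x` where the index stays in range; beyond that it
      -- is free and is taken from `y`. `hx` makes both prescriptions compatible.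
      have h2 : ∀ j < k, zext (fun j : Fin k => if j.val + n < k then zext x (j + n) else
          zext y (j - 1)) j = if j + n < k then zext x (j + n) else zext y (j - 1) :=
        fun j hj => zext_of_lt (fun j => if j + n < k then zext x (j + n) else zext y (j - 1)) hj
      refine ⟨fun j => if j.val + n < k then zext x (j + n) else zext y (j - 1),
        (ih _).2 fun i hi => ?_, (h _ _).2 fun i hi => ?_⟩
      · rw [h2 i (by omega), if_pos hi]
      · rw [h2 (i + 1) hi]
        by_cases hin : i + 1 + n < k
        · rw [if_pos hin, ← hx i (by omega), add_right_comm, add_assoc]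
        · rw [if_neg hin, Nat.add_sub_cancel]

theorem isCoord_ker_iter (h : IsSingularShift T) (n : ℕ) :
    IsCoord (ker (iter T n)) fun j => n ≤ j := by
  intro x
  rw [mem_ker, h.mem_iter]
  constructor
  · intro hx j hj hnj
    have h1 := hx (j - n) (by omega)
    rwa [zext_zero, Nat.sub_add_cancel hnj] at h1
  · intro hx i hi
    rw [zext_zero]
    exact hx _ hi (by omega)

theorem rootMfd_eq_top (h : IsSingularShift T) : rootMfd T 0 = ⊤ := by
  refine eq_top_iff.2 fun x _ => mem_rootMfd.2 ⟨k, ?_⟩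
  rw [shift_zero, (h.isCoord_ker_iter k).eq_top fun j hj => not_le.2 hj]
  exact Submodule.mem_top

/-- Every vector is killed by $k$ shifts, and the condition defining $T^k$ is empty. -/
theorem singChains_eq_top (h : IsSingularShift T) : singChains T = ⊤ := by
  rw [singChains, h.rootMfd_eq_top, top_inf_eq, eq_top_iff]
  refine fun y _ => mem_rootMfdInfty.2 ⟨k, ?_⟩
  rw [mem_mul, h.mem_iter]
  intro i hi
  omega

theorem weyrB_eq (h : IsSingularShift T) (n : ℕ) : weyrB T n = if n < k then 1 else 0 := by
  rw [weyrB, h.singChains_eq_top, inf_top_eq, inf_top_eq]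
  refine (h.isCoord_ker_iter (n + 1)).quotDim_eq (h.isCoord_ker_iter n) n _ ?_ id
  intro j hj
  omega

end IsSingularShift

/-! #### The relation of a block `sKᵀ - Lᵀ` -/

/-- `T` consists of the pairs `(x, y)` such that `y` is `x`, shifted to the right. -/
def IsMultiShift (T : LinRel (Fin k → ℂ)) : Prop :=
  ∀ x y, (x, y) ∈ T ↔ ∀ i, zext y i = if 1 ≤ i then zext x (i - 1) else 0

namespace IsMultiShift

theorem mem_iter (h : IsMultiShift T) (n : ℕ) (x y : Fin k → ℂ) :
    (x, y) ∈ iter T n ↔ ∀ i, zext y i = if n ≤ i then zext x (i - n) else 0 := by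
  induction n generalizing y with
  | zero =>
    rw [mem_iter_zero]
    exact ⟨fun h i => by simp [h], fun h => eq_of_zext_eq fun i _ => by simp [h i]⟩
  | succ n ih =>
    rw [mem_iter_succ]
    have key : ∀ z : Fin k → ℂ, (∀ i, zext z i = if n ≤ i then zext x (i - n) else 0) →
        ∀ i, (if 1 ≤ i then zext z (i - 1) else 0) =
          if n + 1 ≤ i then zext x (i - (n + 1)) else 0 := by
      intro z hz i
      by_cases h1 : 1 ≤ i
      · rw [if_pos h1, hz]
        by_cases h2 : n + 1 ≤ i
        · rw [if_pos h2, if_pos (by omega), Nat.sub_sub, add_comm 1]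
        · rw [if_neg h2, if_neg (by omega)]
      · rw [if_neg h1, if_neg (by omega)]
    constructor
    · rintro ⟨z, hz, hzy⟩ i
      rw [(h z y).1 hzy i, key z ((ih z).1 hz) i]
    · intro hy
      have h2 : ∀ i, zext (fun i : Fin k => if n ≤ i.val then zext x (i - n) else 0) i =
          if n ≤ i then zext x (i - n) else 0 := by
        intro i
        by_cases hi : i < k
        · exact zext_of_lt (fun i => if n ≤ i then zext x (i - n) else 0) hi
        · rw [zext_of_le _ (not_lt.1 hi)]
          by_cases hin : n ≤ i
          · have h3 := hy (i + 1)
            rw [zext_of_le y (by omega), if_pos (by omega), Nat.add_sub_add_right] at h3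
            rw [if_pos hin, h3]
          · rw [if_neg hin]
      exact ⟨_, (ih _).2 h2, (h _ _).2 fun i => (hy i).trans (key _ h2 i).symm⟩

theorem mul_eq_bot (h : IsMultiShift T) : mul T = ⊥ :=
  eq_bot_of_zext fun y hy n _ => by simpa using (h 0 y).1 hy n

theorem ker_shift_eq_bot (h : IsMultiShift T) (μ : ℂ) : ker (T.shift μ) = ⊥ := by
  refine eq_bot_of_zext fun x hx n _ => zext_eq_zero_of_recurrence (fun n _ h0 => ?_) n
  rw [mem_ker, mem_shift, zero_add, h] at hx
  have h1 := hx (n + 1)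
  rw [zext_smul, h0, mul_zero, if_pos (by omega), Nat.add_sub_cancel] at h1
  exact h1.symm

theorem rootMfd_eq_bot (h : IsMultiShift T) : rootMfd T 0 = ⊥ := by
  have := h.ker_shift_eq_bot 0
  rw [shift_zero] at this
  exact rootMfd_zero_eq_bot this

theorem isCoord_ran_iter (h : IsMultiShift T) (n : ℕ) :
    IsCoord (ran (iter T n)) fun j => j < n := by
  intro y
  rw [mem_ran]
  constructor
  · rintro ⟨x, hx⟩ j hj hjn
    rw [(h.mem_iter n x y).1 hx, if_neg (by omega)]
  · intro hy
    refine ⟨fun i => zext y (i + n), (h.mem_iter n _ y).2 fun i => ?_⟩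
    by_cases hi : n ≤ i
    · rw [if_pos hi]
      by_cases hik : i - n < k
      · exact Eq.symm ((zext_of_lt (fun i => zext y (i + n)) hik).trans
          (by rw [Nat.sub_add_cancel hi]))
      · rw [zext_of_le _ (not_lt.1 hik), zext_of_le]
        omega
    · rw [if_neg hi]
      by_cases hik : i < k
      · exact hy i hik (by omega)
      · exact zext_of_le _ (by omega)

theorem isCoord_ran (h : IsMultiShift T) : IsCoord (ran T) fun j => j < 1 := by
  have h1 : iter T 1 = T := by
    ext ⟨x, y⟩
    rw [h.mem_iter, h]
  rw [← h1]
  exact h.isCoord_ran_iter 1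

theorem isCoord_dom (h : IsMultiShift T) : IsCoord (dom T) fun j => k ≤ j + 1 := by
  intro x
  rw [mem_dom]
  constructor
  · rintro ⟨y, hy⟩ j _ hjk
    have h1 := (h x y).1 hy (j + 1)
    rw [zext_of_le y hjk, if_pos (by omega), Nat.add_sub_cancel] at h1
    exact h1.symm
  · intro hx
    refine ⟨fun i => if 1 ≤ i.val then zext x (i - 1) else 0, (h _ _).2 fun i => ?_⟩
    by_cases hi : i < k
    · exact zext_of_lt (fun i => if 1 ≤ i then zext x (i - 1) else 0) hi
    · rw [zext_of_le _ (not_lt.1 hi)]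
      by_cases h1 : 1 ≤ i
      · rw [if_pos h1]
        by_cases hik : i - 1 < k
        · exact (hx _ hik (by omega)).symm
        · exact (zext_of_le _ (by omega)).symm
      · rw [if_neg h1]

/-- The range of $T^n$ is cut out by the vanishing of the first `n` coordinates, so consecutive
ranges differ in one coordinate. In the first term the domain supplies coordinate 0 only if $k\ge
2$: for one column the relation is zero. -/
theorem weyrC_eq (h : IsMultiShift T) (n : ℕ) : weyrC T n = if n + 1 < k then 1 else 0 := by
  cases n with
  | zero =>
    rw [weyrC, h.rootMfd_eq_bot, sup_bot_eq]
    refine (h.isCoord_ran.sup h.isCoord_dom).quotDim_eq h.isCoord_ran 0 _ ?_ ?_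
    · intro j hj
      omega
    · omega
  | succ n =>
    rw [weyrC, h.rootMfd_eq_bot, sup_bot_eq, sup_bot_eq]
    refine (h.isCoord_ran_iter (n + 2)).quotDim_eq (h.isCoord_ran_iter (n + 3)) (n + 2) _ ?_ ?_
    · intro j hj
      omega
    · omega

end IsMultiShift

end Blocks

end LinRel


/-! ### Identification of the block relations as shifts -/

namespace KBlock

theorem sum_ite_mul_eq_zext {k : ℕ} (x : Fin k → ℂ) (t : ℕ) :
    ∑ j : Fin k, (if j.val = t then 1 else 0) * x j = zext x t := by
  by_cases ht : t < k
  · rw [Finset.sum_eq_single (⟨t, ht⟩ : Fin k)]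
    · simp [zext, ht]
    · intro j _ hj
      rw [if_neg fun h => hj (Fin.ext h), zero_mul]
    · simp
  · rw [zext_of_le x (not_lt.1 ht)]
    refine Finset.sum_eq_zero fun j _ => ?_
    rw [if_neg (by omega), zero_mul]

theorem sum_ite_succ_mul_eq_zext {k : ℕ} (x : Fin k → ℂ) (t : ℕ) :
    ∑ j : Fin k, (if t = j.val + 1 then 1 else 0) * x j =
      if 1 ≤ t then zext x (t - 1) else 0 := by
  by_cases ht : 1 ≤ t
  · rw [if_pos ht, ← sum_ite_mul_eq_zext]
    refine Finset.sum_congr rfl fun j _ => ?_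
    congr 1
    exact if_congr (by omega) rfl rfl
  · rw [if_neg ht]
    refine Finset.sum_eq_zero fun j _ => ?_
    rw [if_neg (by omega), zero_mul]

theorem isJordanGraph_rel (ν : ℂ) (k : ℕ) : LinRel.IsJordanGraph (k := k) (fin ν k).rel ν := by
  intro x y
  have hF : ∀ i : Fin k, (fin ν k).matF.mulVec x i = ν * zext x i + zext x (i + 1) := by
    intro i
    rw [← sum_ite_mul_eq_zext x i, ← sum_ite_mul_eq_zext x (i + 1), Finset.mul_sum,
      ← Finset.sum_add_distrib]
    change ∑ j : Fin k, (fin ν k).matF i j * x j = _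
    refine Finset.sum_congr rfl fun j _ => ?_
    by_cases h : i.val = j.val
    · simp [matF, h]
    · simp [matF, h, Ne.symm h]
  have hE : (fin ν k).matE.mulVec y = y := Matrix.one_mulVec y
  refine Iff.trans (mem_kernelRep.trans funext_iff) (Iff.trans ?_ (Fin.forall_iff
    (p := fun n : Fin k => zext y n = ν * zext x n + zext x (n + 1))))
  refine forall_congr' fun i : Fin k => ?_
  rw [hF, hE, zext_val y, eq_comm]

theorem isInvShift_rel (k : ℕ) : LinRel.IsInvShift (k := k) (inf k).rel := by
  intro x y
  have hE : ∀ i : Fin k, (inf k).matE.mulVec y i = if 1 ≤ i.val then zext y (i - 1) else 0 :=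
    fun i => sum_ite_succ_mul_eq_zext y i
  have hF : (inf k).matF.mulVec x = x := Matrix.one_mulVec x
  refine Iff.trans (mem_kernelRep.trans funext_iff) (Iff.trans ?_ (Fin.forall_iff
    (p := fun i : Fin k => zext x i = if 1 ≤ i.val then zext y (i - 1) else 0)))
  refine forall_congr' fun i : Fin k => ?_
  rw [hF, hE, zext_val x]

theorem isSingularShift_rel (k : ℕ) : LinRel.IsSingularShift (k := k) (col k).rel := by
  intro x y
  have hE : ∀ i : Fin (k - 1), (col k).matE.mulVec y i = zext y i :=
    fun i => sum_ite_mul_eq_zext y i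
  have hF : ∀ i : Fin (k - 1), (col k).matF.mulVec x i = zext x (i + 1) :=
    fun i => sum_ite_mul_eq_zext x (i + 1)
  refine Iff.trans (mem_kernelRep.trans funext_iff) ?_
  constructor
  · intro h i hi
    exact (hF ⟨i, by omega⟩).symm.trans ((h ⟨i, by change i < k - 1; omega⟩).trans (hE ⟨i, by omega⟩))
  · intro h (i : Fin (k - 1))
    exact (hF i).trans ((h i (by omega)).trans (hE i).symm)

/-- The last row, of index `k`, reads $0$ on the `y` side and forces the last entry of `x` to be
zero; rows beyond it are trivial. -/
theorem isMultiShift_rel (k : ℕ) : LinRel.IsMultiShift (k := k) (row (k + 1)).rel := by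
  intro x y
  have hE : ∀ i : Fin (k + 1), (row (k + 1)).matE.mulVec y i = zext y i := by
    intro i
    rw [← sum_ite_mul_eq_zext]
    change ∑ j : Fin k, (row (k + 1)).matE i j * y j = _
    exact Finset.sum_congr rfl fun j _ => by simp [matE, eq_comm]
  have hF : ∀ i : Fin (k + 1), (row (k + 1)).matF.mulVec x i =
      if 1 ≤ i.val then zext x (i - 1) else 0 :=
    fun i => sum_ite_succ_mul_eq_zext x i
  refine Iff.trans (mem_kernelRep.trans funext_iff) ?_
  constructor
  · intro h i
    by_cases hi : i < k + 1
    · exact (hE ⟨i, hi⟩).symm.trans ((h ⟨i, hi⟩).symm.trans (hF ⟨i, hi⟩))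
    · rw [zext_of_le y (by omega), zext_of_le x (by omega), ite_self]
  · intro h (i : Fin (k + 1))
    exact (hF i).trans ((h i).symm.trans (hE i).symm)

end KBlock

/-! ### Sums over the blocks of a Kronecker canonical form -/

theorem conjPart_eq_sum (l : List ℕ) (j : ℕ) :
    conjPart l j = (l.map fun k => if j < k then 1 else 0).sum := by
  induction l with
  | nil => rfl
  | cons k l ih =>
    rw [conjPart, List.countP_cons, List.map_cons, List.sum_cons, ← ih, conjPart, add_comm]
    simp

theorem finite_support_conjPart (l : List ℕ) : (Function.support (conjPart l)).Finite := by
  refine (Set.finite_lt_nat (l.sum + 1)).subset fun j hj => ?_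
  by_contra h
  refine hj (List.countP_eq_zero.2 fun k hk => ?_)
  have h1 := List.single_le_sum (fun x _ => Nat.zero_le x) k hk
  simp only [Set.mem_ofPred_eq, not_lt] at h
  simp only [decide_eq_true_eq, not_lt]
  omega

/-- Double counting: an entry `k` contributes one to each of the terms `j < k`. -/
theorem seqAbs_conjPart (l : List ℕ) : seqAbs (conjPart l) = l.sum := by
  induction l with
  | nil => exact finsum_zero
  | cons k l ih =>
    have h1 : ∀ j, conjPart (k :: l) j = (if j < k then 1 else 0) + conjPart l j := fun j => by
      rw [conjPart_eq_sum, List.map_cons, List.sum_cons, ← conjPart_eq_sum]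
    have h2 : Function.support (fun j => if j < k then 1 else 0) ⊆ (Finset.range k : Set ℕ) := by
      intro j hj
      by_contra h
      exact hj (if_neg (by simpa using h))
    rw [seqAbs, finsum_congr h1, finsum_add_distrib ((Finset.range k).finite_toSet.subset h2)
      (finite_support_conjPart l), show ∑ᶠ j, conjPart l j = l.sum from ih, finsum_eq_sum_of_support_subset _ h2,
      List.sum_cons, Finset.sum_ite_of_true fun j hj => Finset.mem_range.1 hj]
    simp

/-- Finiteness of the support is carried along because additivity of `finsum` needs it in the
induction. -/
theorem finsum_sum_map_filter (l : List (ℂ × ℕ)) :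
    ∑ᶠ μ : ℂ, ((l.filter fun p => p.1 = μ).map Prod.snd).sum = (l.map Prod.snd).sum ∧
      (Function.support fun μ : ℂ => ((l.filter fun p => p.1 = μ).map Prod.snd).sum).Finite := by
  induction l with
  | nil => simp
  | cons p l ih =>
    have h1 : (fun μ : ℂ => (((p :: l).filter fun p => p.1 = μ).map Prod.snd).sum) = fun μ : ℂ =>
        (if p.1 = μ then p.2 else 0) + ((l.filter fun p => p.1 = μ).map Prod.snd).sum := by
      ext μ
      by_cases h : p.1 = μ <;> simp [h]
    have h2 : (Function.support fun μ : ℂ => if p.1 = μ then p.2 else 0) ⊆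
        ({p.1} : Finset ℂ) := by
      intro μ hμ
      by_contra h
      exact hμ (if_neg fun h' => h (by simp [h']))
    have h3 := ({p.1} : Finset ℂ).finite_toSet.subset h2
    rw [h1]
    refine ⟨?_, (h3.union ih.2).subset (Function.support_add _ _)⟩
    rw [finsum_add_distrib h3 ih.2, ih.1, finsum_eq_sum_of_support_subset _ h2]
    simp

namespace KroneckerData

variable (K : KroneckerData)

theorem famAbs_segre : famAbs (fun μ => conjPart (K.segre μ)) = (K.jordan.map Prod.snd).sum := by
  rw [famAbs, ← (finsum_sum_map_filter K.jordan).1]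
  exact finsum_congr fun μ => seqAbs_conjPart _

theorem conjPart_segre (μ : ℂ) (j : ℕ) : conjPart (K.segre μ) j =
    (K.jordan.map fun p => if p.1 = μ ∧ j < p.2 then 1 else 0).sum := by
  rw [conjPart_eq_sum, segre, List.map_map]
  induction K.jordan with
  | nil => rfl
  | cons p l ih =>
    by_cases h : p.1 = μ <;> simp [h, ← ih]

theorem sum_blocks (g : KBlock → ℕ) : ∑ i, g (K.blocks.get i) =
    (K.jordan.map fun p => g (KBlock.fin p.1 p.2)).sum + (K.α.map fun k => g (KBlock.inf k)).sum +
      (K.β.map fun k => g (KBlock.col k)).sum + (K.γ.map fun k => g (KBlock.row k)).sum := by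
  have h1 : ∑ i, g (K.blocks.get i) = (K.blocks.map g).sum := by
    rw [← List.sum_ofFn]
    congr 1
    conv_rhs => rw [← List.ofFn_get K.blocks, List.map_ofFn]
    rfl
  rw [h1, blocks]
  simp only [List.map_append, List.sum_append, List.map_map]
  rfl

theorem sum_map_eq_zero {α : Type*} (l : List α) {g : α → ℕ} (h : ∀ a ∈ l, g a = 0) :
    (l.map g).sum = 0 :=
  List.sum_eq_zero fun _ hx => by
    obtain ⟨a, ha, rfl⟩ := List.mem_map.1 hx
    exact h a ha

variable {K}

theorem weyrW_blocks (μ : ℂ) (j : ℕ) : ∑ i, (K.blocks.get i).rel.weyrW μ j = conjPart (K.segre μ) j := by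
  have hα : (K.α.map fun k => (KBlock.inf k).rel.weyrW μ j).sum = 0 :=
    sum_map_eq_zero _ fun k _ => LinRel.weyrW_eq_zero_of_ker
      ((KBlock.isInvShift_rel k).ker_shift_eq_bot μ) j
  have hβ : (K.β.map fun k => (KBlock.col k).rel.weyrW μ j).sum = 0 :=
    sum_map_eq_zero _ fun k _ => LinRel.weyrW_eq_zero_of_top
      (KBlock.isSingularShift_rel k).singChains_eq_top μ j
  have hγ : (K.γ.map fun k => (KBlock.row k).rel.weyrW μ j).sum = 0 := sum_map_eq_zero _ fun k hk => by
    obtain ⟨k, rfl⟩ := Nat.exists_eq_succ_of_ne_zero (K.γ_pos k hk).ne'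
    exact LinRel.weyrW_eq_zero_of_ker ((KBlock.isMultiShift_rel k).ker_shift_eq_bot μ) j
  rw [K.sum_blocks fun b => b.rel.weyrW μ j, hα, hβ, hγ, conjPart_segre]
  simp only [add_zero]
  refine congrArg List.sum (List.map_congr_left fun p _ => ?_)
  exact (KBlock.isJordanGraph_rel p.1 p.2).weyrW_eq μ j

theorem weyrA_blocks (j : ℕ) : ∑ i, (K.blocks.get i).rel.weyrA j = conjPart K.α j := by
  have hJ : (K.jordan.map fun p => (KBlock.fin p.1 p.2).rel.weyrA j).sum = 0 :=
    sum_map_eq_zero _ fun p _ => LinRel.weyrA_eq_zero_of_mul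
      (KBlock.isJordanGraph_rel p.1 p.2).mul_eq_bot j
  have hβ : (K.β.map fun k => (KBlock.col k).rel.weyrA j).sum = 0 :=
    sum_map_eq_zero _ fun k _ => LinRel.weyrA_eq_zero_of_top
      (KBlock.isSingularShift_rel k).singChains_eq_top j
  have hγ : (K.γ.map fun k => (KBlock.row k).rel.weyrA j).sum = 0 := sum_map_eq_zero _ fun k hk => by
    obtain ⟨k, rfl⟩ := Nat.exists_eq_succ_of_ne_zero (K.γ_pos k hk).ne'
    exact LinRel.weyrA_eq_zero_of_mul (KBlock.isMultiShift_rel k).mul_eq_bot j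
  rw [K.sum_blocks fun b => b.rel.weyrA j, hJ, hβ, hγ, conjPart_eq_sum]
  simp only [zero_add, add_zero]
  refine congrArg List.sum (List.map_congr_left fun k _ => ?_)
  exact (KBlock.isInvShift_rel k).weyrA_eq j

theorem weyrB_blocks (j : ℕ) : ∑ i, (K.blocks.get i).rel.weyrB j = conjPart K.β j := by
  have hJ : (K.jordan.map fun p => (KBlock.fin p.1 p.2).rel.weyrB j).sum = 0 :=
    sum_map_eq_zero _ fun p _ => LinRel.weyrB_eq_zero
      (LinRel.singChains_eq_bot_of_mul (KBlock.isJordanGraph_rel p.1 p.2).mul_eq_bot) j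
  have hα : (K.α.map fun k => (KBlock.inf k).rel.weyrB j).sum = 0 :=
    sum_map_eq_zero _ fun k _ => LinRel.weyrB_eq_zero
      (LinRel.singChains_eq_bot_of_ker (KBlock.isInvShift_rel k).ker_eq_bot) j
  have hγ : (K.γ.map fun k => (KBlock.row k).rel.weyrB j).sum = 0 := sum_map_eq_zero _ fun k hk => by
    obtain ⟨k, rfl⟩ := Nat.exists_eq_succ_of_ne_zero (K.γ_pos k hk).ne'
    exact LinRel.weyrB_eq_zero
      (LinRel.singChains_eq_bot_of_mul (KBlock.isMultiShift_rel k).mul_eq_bot) j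
  rw [K.sum_blocks fun b => b.rel.weyrB j, hJ, hα, hγ, conjPart_eq_sum]
  simp only [zero_add, add_zero]
  refine congrArg List.sum (List.map_congr_left fun k _ => ?_)
  exact (KBlock.isSingularShift_rel k).weyrB_eq j

/-- A block with $k+1$ rows has `k` columns and contributes to term `j` exactly if $j+1<k$, that is
$j+2<k+1$: hence the shift by two. -/
theorem weyrC_blocks (j : ℕ) : ∑ i, (K.blocks.get i).rel.weyrC j = conjPart K.γ (j + 2) := by
  have hJ : (K.jordan.map fun p => (KBlock.fin p.1 p.2).rel.weyrC j).sum = 0 :=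
    sum_map_eq_zero _ fun p _ => (KBlock.isJordanGraph_rel p.1 p.2).weyrC_eq_zero j
  have hα : (K.α.map fun k => (KBlock.inf k).rel.weyrC j).sum = 0 :=
    sum_map_eq_zero _ fun k _ => LinRel.weyrC_eq_zero_of_ran
      (KBlock.isInvShift_rel k).ran_eq_top j
  have hβ : (K.β.map fun k => (KBlock.col k).rel.weyrC j).sum = 0 :=
    sum_map_eq_zero _ fun k _ => LinRel.weyrC_eq_zero_of_rootMfd
      (KBlock.isSingularShift_rel k).rootMfd_eq_top j
  rw [K.sum_blocks fun b => b.rel.weyrC j, hJ, hα, hβ, conjPart_eq_sum]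
  simp only [zero_add, add_zero]
  refine congrArg List.sum (List.map_congr_left fun k hk => ?_)
  obtain ⟨k, rfl⟩ := Nat.exists_eq_succ_of_ne_zero (K.γ_pos k hk).ne'
  exact ((KBlock.isMultiShift_rel k).weyrC_eq j).trans (if_congr (by omega) rfl rfl)

variable {n m : ℕ} {E F : Matrix (Fin n) (Fin m) ℂ}

/-- The Weyr characteristic of the kernel representation of a pencil with canonical form `K`. -/
theorem IsFormOf.weyrChar_kernelRep (h : K.IsFormOf E F) : (kernelRep E F).weyrChar =
    ⟨fun μ => conjPart (K.segre μ), conjPart K.α, conjPart K.β, fun j => conjPart K.γ (j + 2)⟩ := by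
  obtain ⟨φ, hφ⟩ := h.exists_relProd
  ext
  · exact (hφ.weyrW _ _).trans (weyrW_blocks _ _)
  · exact (hφ.weyrA _).trans (weyrA_blocks _)
  · exact (hφ.weyrB _).trans (weyrB_blocks _)
  · exact (hφ.weyrC _).trans (weyrC_blocks _)

theorem IsFormOf.rows_eq (h : K.IsFormOf E F) : n = (K.jordan.map Prod.snd).sum + K.α.sum +
    (K.β.map fun k => k - 1).sum + K.γ.sum := by
  obtain ⟨e, -⟩ := h
  have h1 := Fintype.card_congr e
  rw [Fintype.card_sigma, Fintype.card_fin] at h1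
  simp only [Fintype.card_fin] at h1
  rw [← h1, K.sum_blocks KBlock.rows]
  simp [KBlock.rows]

theorem IsFormOf.cols_eq (h : K.IsFormOf E F) : m = (K.jordan.map Prod.snd).sum + K.α.sum +
    K.β.sum + (K.γ.map fun k => k - 1).sum := by
  obtain ⟨-, f, -⟩ := h
  have h1 := Fintype.card_congr f
  rw [Fintype.card_sigma, Fintype.card_fin] at h1
  simp only [Fintype.card_fin] at h1
  rw [← h1, K.sum_blocks KBlock.cols]
  simp [KBlock.cols]

end KroneckerData


/-! ### The minimal number of rows -/

section Minimality

variable {n m : ℕ}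

/-- The linear map `(x, y) ↦ F x - E y`, whose kernel is the kernel representation. -/
def pencilMap (E F : Matrix (Fin n) (Fin m) ℂ) :
    ((Fin m → ℂ) × (Fin m → ℂ)) →ₗ[ℂ] (Fin n → ℂ) :=
  F.mulVecLin ∘ₗ LinearMap.fst ℂ _ _ - E.mulVecLin ∘ₗ LinearMap.snd ℂ _ _

theorem ker_pencilMap (E F : Matrix (Fin n) (Fin m) ℂ) :
    LinearMap.ker (pencilMap E F) = kernelRep E F := by
  ext p
  exact LinearMap.mem_ker.trans sub_eq_zero

theorem finrank_range_pencilMap (E F : Matrix (Fin n) (Fin m) ℂ) :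
    finrank ℂ (LinearMap.range (pencilMap E F)) + finrank ℂ (kernelRep E F) = 2 * m := by
  rw [← ker_pencilMap, LinearMap.finrank_range_add_finrank_ker, finrank_prod, finrank_fin_fun,
    two_mul]

theorem two_mul_le_of_kernelRep (E F : Matrix (Fin n) (Fin m) ℂ) :
    2 * m ≤ n + finrank ℂ (kernelRep E F) := by
  have h1 := Submodule.finrank_le (LinearMap.range (pencilMap E F))
  rw [finrank_fin_fun] at h1
  have h2 := finrank_range_pencilMap E F
  omega

theorem pencilMap_surjective {E F : Matrix (Fin n) (Fin m) ℂ}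
    (h : n + finrank ℂ (kernelRep E F) = 2 * m) : Function.Surjective (pencilMap E F) := by
  refine LinearMap.range_eq_top.1 (Submodule.eq_top_of_finrank_eq ?_)
  rw [finrank_fin_fun]
  have h2 := finrank_range_pencilMap E F
  omega

theorem exists_kernelRep_eq (S : LinRel (Fin m → ℂ)) (h : n + finrank ℂ S = 2 * m) :
    ∃ E F : Matrix (Fin n) (Fin m) ℂ, kernelRep E F = S := by
  have h1 : finrank ℂ (((Fin m → ℂ) × (Fin m → ℂ)) ⧸ S) = finrank ℂ (Fin n → ℂ) := by
    have h2 := Submodule.finrank_quotient_add_finrank S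
    rw [finrank_prod, finrank_fin_fun] at h2
    rw [finrank_fin_fun]
    omega
  let e := LinearEquiv.ofFinrankEq _ _ h1
  let L := e.toLinearMap ∘ₗ S.mkQ
  refine ⟨-LinearMap.toMatrix' (L ∘ₗ LinearMap.inr ℂ _ _),
    LinearMap.toMatrix' (L ∘ₗ LinearMap.inl ℂ _ _), ?_⟩
  ext ⟨x, y⟩
  rw [mem_kernelRep, Matrix.neg_mulVec, LinearMap.toMatrix'_mulVec, LinearMap.toMatrix'_mulVec,
    eq_neg_iff_add_eq_zero]
  have h3 : (L ∘ₗ LinearMap.inl ℂ _ _) x + (L ∘ₗ LinearMap.inr ℂ _ _) y = L (x, y) := by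
    change L (x, 0) + L (0, y) = L (x, y)
    rw [← map_add, Prod.mk_add_mk, add_zero, zero_add]
  rw [h3]
  change e (S.mkQ (x, y)) = 0 ↔ _
  rw [LinearEquiv.map_eq_zero_iff, Submodule.mkQ_apply, Submodule.Quotient.mk_eq_zero]

theorem KBlock.mulVec_row_one {b : KBlock} (h : b = KBlock.row 1)
    (M : Matrix (Fin b.rows) (Fin b.cols) ℂ) (x : Fin b.cols → ℂ) : M.mulVec x = 0 := by
  subst h
  ext r
  change ∑ j : Fin 0, M r j * x j = 0
  exact Finset.sum_eq_zero fun j _ => j.elim0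

namespace KroneckerData.IsFormOf

variable {K : KroneckerData} {E F : Matrix (Fin n) (Fin m) ℂ}

/-- A pencil without redundant rows has no zero rows in its canonical form. -/
theorem two_le_of_mem_γ (h : K.IsFormOf E F) (hs : Function.Surjective (pencilMap E F)) :
    ∀ k ∈ K.γ, 2 ≤ k := by
  intro k hk
  by_contra hlt
  obtain rfl : k = 1 := by
    have := K.γ_pos k hk
    omega
  have hmem : KBlock.row 1 ∈ K.blocks := by
    simp only [blocks, List.mem_append]
    exact Or.inr (List.mem_map.2 ⟨1, hk, rfl⟩)
  obtain ⟨i, hi⟩ := List.mem_iff_get.1 hmem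
  obtain ⟨φ, ψ, hφ⟩ := h.exists_linearEquiv
  -- The component of any image in a block without columns is zero, so the vector of ones would have
  -- no preimage.
  obtain ⟨⟨x, y⟩, hxy⟩ := hs (ψ.symm fun _ _ => 1)
  have h1 : ψ (F.mulVec x - E.mulVec y) i = fun _ => 1 :=
    congrFun ((congrArg ψ hxy).trans (ψ.apply_symm_apply _)) i
  rw [map_sub, Pi.sub_apply, (hφ x i).2, (hφ y i).1, KBlock.mulVec_row_one hi,
    KBlock.mulVec_row_one hi, sub_zero] at h1
  have h2 : 0 < (K.blocks.get i).rows := by rw [hi]; exact one_pos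
  exact zero_ne_one (congrFun h1 ⟨0, h2⟩)

theorem sum_map_sub_one {l : List ℕ} (h : ∀ k ∈ l, 1 ≤ k) :
    (l.map fun k => k - 1).sum + l.length = l.sum := by
  induction l with
  | nil => rfl
  | cons k l ih =>
    have h1 := h k List.mem_cons_self
    have h2 := ih fun k hk => h k (List.mem_cons_of_mem _ hk)
    simp only [List.map_cons, List.sum_cons, List.length_cons]
    omega

theorem sum_map_sub_two {l : List ℕ} (h : ∀ k ∈ l, 2 ≤ k) :
    (l.map fun k => k - 2).sum + 2 * l.length = l.sum := by
  induction l with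
  | nil => rfl
  | cons k l ih =>
    have h1 := h k List.mem_cons_self
    have h2 := ih fun k hk => h k (List.mem_cons_of_mem _ hk)
    simp only [List.map_cons, List.sum_cons, List.length_cons]
    omega

theorem conjPart_eq_length {l : List ℕ} {j : ℕ} (h : ∀ k ∈ l, j < k) :
    conjPart l j = l.length :=
  List.countP_eq_length.2 fun k hk => by simpa using h k hk

theorem seqAbs_conjPart_add_two (l : List ℕ) :
    seqAbs (fun j => conjPart l (j + 2)) = (l.map fun k => k - 2).sum := by
  rw [← seqAbs_conjPart]
  congr 1
  ext j
  rw [conjPart, conjPart, List.countP_map]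
  refine List.countP_congr fun k _ => ?_
  simp only [Function.comp_apply, decide_eq_true_eq]
  omega

/-- The Weyr characteristic and the size of a pencil without redundant rows, in terms of its
kernel representation. -/
theorem weyrChar_eq (h : K.IsFormOf E F) (hs : Function.Surjective (pencilMap E F))
    {W : ℂ → ℕ → ℕ} {A B C : ℕ → ℕ} (hS : (kernelRep E F).weyrChar = ⟨W, A, B, C⟩) :
    K.weyrChar = ⟨W, A, B, seqCons K.γ.length (seqCons K.γ.length C)⟩ ∧
    (K.γ.length : ℤ) = m - famAbs W - seqAbs A - seqAbs B - seqAbs C ∧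
    (n : ℤ) = 2 * m - famAbs W - seqAbs A - seqAbs B - B 0 - seqAbs C := by
  have hγ := h.two_le_of_mem_γ hs
  rw [h.weyrChar_kernelRep] at hS
  obtain ⟨rfl, rfl, rfl, rfl⟩ := WeyrChar.mk.inj hS
  refine ⟨?_, ?_⟩
  · ext j
    · rfl
    · rfl
    · rfl
    · match j with
      | 0 => exact conjPart_eq_length K.γ_pos
      | 1 => exact conjPart_eq_length hγ
      | j + 2 => rfl
  · have h1 := h.rows_eq
    have h2 := h.cols_eq
    have h3 := sum_map_sub_one K.β_pos
    have h4 := sum_map_sub_one K.γ_pos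
    have h5 := sum_map_sub_two hγ
    -- With $d$ the number of $\gamma_i$ one has $|\gamma|=|C|+2d$. The columns number
    -- $|W|+|A|+|B|+|\gamma|-d=m$ and the rows $|W|+|A|+|B|-B_1+|\gamma|=n$.
    rw [famAbs_segre, seqAbs_conjPart, seqAbs_conjPart, seqAbs_conjPart_add_two,
      conjPart_eq_length K.β_pos]
    omega

end KroneckerData.IsFormOf

end Minimality

theorem mainTheorem6 (m : ℕ) (S : LinRel (Fin m → ℂ)) (W : ℂ → ℕ → ℕ) (A B C : ℕ → ℕ)
    (hS : S.weyrChar = ⟨W, A, B, C⟩) :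
    ∃ n d : ℕ,
      (n : ℤ) = 2 * m - famAbs W - seqAbs A - seqAbs B - B 0 - seqAbs C ∧
      (d : ℤ) = m - famAbs W - seqAbs A - seqAbs B - seqAbs C ∧
      IsLeast {r : ℕ | ∃ E F : Matrix (Fin r) (Fin m) ℂ, kernelRep E F = S} n ∧
      ∀ E F : Matrix (Fin n) (Fin m) ℂ, kernelRep E F = S →
        IsPencilWeyrChar E F ⟨W, A, B, seqCons d (seqCons d C)⟩ := by
  have hdim : finrank ℂ S ≤ 2 * m := by
    have h := Submodule.finrank_le S
    rwa [finrank_prod, finrank_fin_fun, ← two_mul] at h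
  -- The minimal number of rows is the codimension of `S`.
  have hn : 2 * m - finrank ℂ S + finrank ℂ S = 2 * m := Nat.sub_add_cancel hdim
  obtain ⟨E₀, F₀, h₀⟩ := exists_kernelRep_eq S hn
  obtain ⟨K₀, hK₀⟩ := exists_isFormOf E₀ F₀
  obtain ⟨-, hd, hrows⟩ := hK₀.weyrChar_eq (pencilMap_surjective (by rw [h₀, hn]))
    (by rw [h₀, hS])
  refine ⟨2 * m - finrank ℂ S, K₀.γ.length, hrows, hd, ⟨⟨E₀, F₀, h₀⟩, ?_⟩, ?_⟩
  · rintro r ⟨E, F, rfl⟩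
    have := two_mul_le_of_kernelRep E F
    omega
  · rintro E F h
    refine ⟨exists_isFormOf E F, fun K hK => ?_⟩
    -- The number of $\gamma_i$ is given by `m` and the invariants of `S` alone, so it agrees with
    -- that of the reference form `K₀`.
    obtain ⟨hK', hd', -⟩ := hK.weyrChar_eq (pencilMap_surjective (by rw [h, hn])) (by rw [h, hS])
    rw [hK', show K.γ.length = K₀.γ.length by omega]
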